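/- Let $N\ge 2$, let $\hbar$ and $p$ be indeterminates, $q=e^{\hbar}$, and let $q^{\pm c/2}$ be an invertible central element. Put $p^*=pq^{-2c}$, $[2]_q=q+q^{-1}$, $\delta(z)=\sum_{n\in\mathbb Z}z^n$, $(x;t_1,\dots,t_k)_\infty=\exp\bigl(-\sum_{n\ge1}\frac{x^n}{n(1-t_1^n)\cdots(1-t_k^n)}\bigr)$ (the formal version of $\prod_{n_1,\dots,n_k\ge0}(1-xt_1^{n_1}\cdots t_k^{n_k})$), $\{x\}=(x;p,q^{2N})_\infty$, and let $\{x\}^*$ be $\{x\}$ with $p$ replaced by $p^*$. Set $$\rho^+_+(x)=\frac{\{q^2x\}^*\{q^{2N-2}x\}^*\{x\}\{q^{2N}x\}}{\{x\}^*\{q^{2N}x\}^*\{q^2x\}\{q^{2N-2}x\}},\qquad \kappa=\frac{(p;p)_\infty(p^*q^2;p^*)_\infty}{(p^*;p^*)_\infty(pq^2;p)_\infty}.$$ Let $\bar\epsilon_l=\epsilon_l-\frac1N\sum_i\epsilon_i\in\mathbb C^N$ $(1\le l\le N)$, $\alpha_j=\bar\epsilon_j-\bar\epsilon_{j+1}$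 $(1\le j\le N-1)$, and let $W\subset\mathbb C^N$ be the hyperplane of vectors with coordinate sum $0$. Let $\mathbb F$ be the field of meromorphic functions $g(P+h,P)$ of $(P+h,P)\in W\times W$, with scalars extended to Laurent series in $\hbar$ (that is, $\mathbb F=\mathcal M(W\times W)((\hbar))$); $h_{\bar\epsilon_l}$ denotes the $l$-th coordinate of $(P+h)-P$. The algebra $U'_{q,p}(\widehat{\mathfrak{gl}}_N)$ is the $p$-adically complete and separated, $p$-torsion-free topological algebra with central variable $p$, generated by $\mathbb F$, the central elements $q^{\pm c/2}$, and $e_{j,m},f_{j,m},k_{l,m}$ $(1\le j\le N-1,\ 1\le l\le N,\ m\in\mathbb Z)$. Its relations are written with $e_j(z)=\sum_m e_{j,m}z^{-m}$, $f_j(z)=\sum_m f_{j,m}z^{-m}$, $$k_l^+(z)=\sum_{m\ge0}k_{l,-m}z^m+\sum_{m>0}k_{l,m}p^mz^{-m},\qquad k_l^-(z)=q^{2h_{\bar\epsilon_l}}k_l^+(pq^{-c}z).$$ The series $k_l^+(z)$ is required to have a two-sided inverse of the same shape. $\mathbb F$ is a subring in which the constants are $\mathbb C((\hbar))$, and for $g\in\mathbb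 F$ $$g(P+h,P)e_j(z)=e_j(z)g(P+h,P-\alpha_j),\quad g(P+h,P)f_j(z)=f_j(z)g(P+h-\alpha_j,P),\quad g(P+h,P)k_l^+(z)=k_l^+(z)g(P+h-\bar\epsilon_l,P-\bar\epsilon_l).$$ The remaining relations are identities of formal Laurent series. Each structure function is a power series in its displayed argument, a ratio $z_a/z_b$, $z_a/w$ or $w/z_a$ up to a coefficient. For $k$ and $k$, with $j<l$ in the second relation: $$\rho^+_+(z_2/z_1)k_l^+(z_1)k_l^+(z_2)=\rho^+_+(z_1/z_2)k_l^+(z_2)k_l^+(z_1),$$ $$\rho^+_+(\tfrac{z_2}{z_1})\frac{(p^*\frac{z_2}{z_1};p^*)_\infty(pq^2\frac{z_2}{z_1};p)_\infty}{(p^*q^2\frac{z_2}{z_1};p^*)_\infty(p\frac{z_2}{z_1};p)_\infty}k_j^+(z_1)k_l^+(z_2)=\rho^+_+(\tfrac{z_1}{z_2})\frac{(q^{-2}\frac{z_1}{z_2};p^*)_\infty(\frac{z_1}{z_2};p)_\infty}{(\frac{z_1}{z_2};p^*)_\infty(q^{-2}\frac{z_1}{z_2};p)_\infty}k_l^+(z_2)k_j^+(z_1).$$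 For $k$ with $e$ and $f$: $$\frac{(p^*q^{c+2-j}\frac{z_2}{z_1};p^*)_\infty}{(p^*q^{c-j}\frac{z_2}{z_1};p^*)_\infty}k_j^+(z_1)e_j(z_2)=q^{-1}\frac{(q^{-c+j}\frac{z_1}{z_2};p^*)_\infty}{(q^{-c-2+j}\frac{z_1}{z_2};p^*)_\infty}e_j(z_2)k_j^+(z_1),$$ $$\frac{(p^*q^{c-2-j}\frac{z_2}{z_1};p^*)_\infty}{(p^*q^{c-j}\frac{z_2}{z_1};p^*)_\infty}k_{j+1}^+(z_1)e_j(z_2)=q\frac{(q^{-c+j}\frac{z_1}{z_2};p^*)_\infty}{(q^{-c+2+j}\frac{z_1}{z_2};p^*)_\infty}e_j(z_2)k_{j+1}^+(z_1),$$ $$\frac{(pq^{-j}\frac{z_2}{z_1};p)_\infty}{(pq^{2-j}\frac{z_2}{z_1};p)_\infty}k_j^+(z_1)f_j(z_2)=q\frac{(q^{-2+j}\frac{z_1}{z_2};p)_\infty}{(q^{j}\frac{z_1}{z_2};p)_\infty}f_j(z_2)k_j^+(z_1),$$ $$\frac{(pq^{-j}\frac{z_2}{z_1};p)_\infty}{(pq^{-2-j}\frac{z_2}{z_1};p)_\infty}k_{j+1}^+(z_1)f_j(z_2)=q^{-1}\frac{(q^{2+j}\frac{z_1}{z_2};p)_\infty}{(q^{j}\frac{z_1}{z_2};p)_\infty}f_j(z_2)k_{j+1}^+(z_1),$$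 and $k_l^+(z_1)$ commutes with $e_j(z_2)$ and $f_j(z_2)$ for $l\ne j,j+1$. For $e$ and $e$: $$z_1\frac{(q^2\frac{z_2}{z_1};p^*)_\infty}{(p^*q^{-2}\frac{z_2}{z_1};p^*)_\infty}e_j(z_1)e_j(z_2)=-z_2\frac{(q^2\frac{z_1}{z_2};p^*)_\infty}{(p^*q^{-2}\frac{z_1}{z_2};p^*)_\infty}e_j(z_2)e_j(z_1),$$ $$z_1\frac{(q^{-1}\frac{z_2}{z_1};p^*)_\infty}{(p^*q\frac{z_2}{z_1};p^*)_\infty}e_j(z_1)e_{j+1}(z_2)=-z_2\frac{(q^{-1}\frac{z_1}{z_2};p^*)_\infty}{(p^*q\frac{z_1}{z_2};p^*)_\infty}e_{j+1}(z_2)e_j(z_1),$$ and $[e_j(z_1),e_l(z_2)]=0$ for $|j-l|>1$. The same three relations hold for $f$ with $p^*$ replaced by $p$ and with $q^{2},q^{-2},q^{-1},q$ replaced by $q^{-2},q^{2},q,q^{-1}$ in the structure functions. For $e$ and $f$: $$[e_i(z_1),f_j(z_2)]=\frac{\delta_{i,j}\kappa}{q-q^{-1}}\Bigl(\delta(q^{-c}\tfrac{z_1}{z_2})k_j^-(q^{-j}z_1)k_{j+1}^-(q^{-j}z_1)^{-1}-\delta(q^{c}\tfrac{z_1}{z_2})k_j^+(q^{-j}z_2)k_{j+1}^+(q^{-j}z_2)^{-1}\Bigr).$$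 The Serre relations, for $|i-j|=1$: with $\varphi(x)=\frac{(p^*q^2x;p^*)_\infty}{(p^*q^{-2}x;p^*)_\infty}$ and $\psi(x)=\frac{(p^*q^{-1}x;p^*)_\infty}{(p^*qx;p^*)_\infty}$, $$\varphi(\tfrac{z_2}{z_1})\Bigl\{\psi(\tfrac{z_1}{w})\psi(\tfrac{z_2}{w})e_j(w)e_i(z_1)e_i(z_2)-[2]_q\psi(\tfrac{w}{z_1})\psi(\tfrac{z_2}{w})e_i(z_1)e_j(w)e_i(z_2)+\psi(\tfrac{w}{z_1})\psi(\tfrac{w}{z_2})e_i(z_1)e_i(z_2)e_j(w)\Bigr\}+(z_1\leftrightarrow z_2)=0,$$ and the same for $f$ with $\varphi(x)=\frac{(pq^{-2}x;p)_\infty}{(pq^2x;p)_\infty}$ and $\psi(x)=\frac{(pqx;p)_\infty}{(pq^{-1}x;p)_\infty}$. **Proposition.** Let $K(z)=k_1^+(z)\,k_2^+(q^{-2}z)\cdots k_N^+(q^{-2(N-1)}z)$. Then every coefficient of $K(z)$ lies in the center of $U'_{q,p}(\widehat{\mathfrak{gl}}_N)$. -/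

import Mathlib

open scoped PowerSeries LaurentPolynomial LaurentSeries

noncomputable section

namespace EllipticGL

/-! ### The coefficient field of the dynamical parameters -/

/-- The `(N-1)`-dimensional space of vectors in `ℂ^N` with coordinate sum zero.  A point `y` of it
records the values `y i` of the parameters `P_{ε̄_i}` (or `(P+h)_{ε̄_i}`), `1 ≤ i ≤ N`. -/
abbrev W (N : ℕ) : Submodule ℂ (Fin N → ℂ) :=
  LinearMap.ker (∑ i : Fin N, (LinearMap.proj i : (Fin N → ℂ) →ₗ[ℂ] ℂ))

/-- `ε̄_l = ε_l - (1/N) ∑_i ε_i`. -/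
def epsBar {N : ℕ} (l : Fin N) : W N :=
  ⟨fun i => (if i = l then 1 else 0) - 1 / (N : ℂ), by
    have hN : (N : ℂ) ≠ 0 := by
      have := l.pos
      exact_mod_cast this.ne'
    simp [LinearMap.mem_ker, Finset.sum_sub_distrib, hN]⟩

/-- The node `j` (that is, the index `j` of `k_j`), for `j = 1, …, N-1`. -/
def lo {N : ℕ} (j : Fin (N - 1)) : Fin N := ⟨j.1, by omega⟩

/-- The index `j+1` of `k_{j+1}`, for `j = 1, …, N-1`. -/
def hi {N : ℕ} (j : Fin (N - 1)) : Fin N := ⟨j.1 + 1, by omega⟩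

/-- The integer label `j ∈ {1, …, N}` of an index. -/
def lab {m : ℕ} (j : Fin m) : ℤ := (j.1 : ℤ) + 1

/-- The simple root `α_j = ε̄_j - ε̄_{j+1}`. -/
def alpha {N : ℕ} (j : Fin (N - 1)) : W N := epsBar (lo j) - epsBar (hi j)

/-- Entire functions `f(P+h, P)` of the dynamical parameters; the first argument is the value of
`P+h`, the second the value of `P`. -/
def entire (N : ℕ) : Subalgebra ℂ (W N × W N → ℂ) where
  carrier := {f | Differentiable ℂ f}
  mul_mem' hf hg := Differentiable.mul hf hg
  add_mem' hf hg := Differentiable.add hf hg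
  algebraMap_mem' c := differentiable_const c

instance (N : ℕ) : IsDomain (entire N) := by
  have : NoZeroDivisors (entire N) := by
    refine ⟨fun {f g} hfg => ?_⟩
    by_contra! hne
    obtain ⟨hf, hg⟩ := hne
    obtain ⟨x, hx⟩ : ∃ x, f.1 x ≠ 0 := by
      by_contra! h
      exact hf (Subtype.ext (funext h))
    obtain ⟨y, hy⟩ : ∃ y, g.1 y ≠ 0 := by
      by_contra! h
      exact hg (Subtype.ext (funext h))
    have hline : Differentiable ℂ fun t : ℂ => x + t • (y - x) := by fun_prop
    have hfd : Differentiable ℂ fun t : ℂ => f.1 (x + t • (y - x)) :=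
      Differentiable.comp f.2 hline
    have hgd : Differentiable ℂ fun t : ℂ => g.1 (x + t • (y - x)) :=
      Differentiable.comp g.2 hline
    have hprod : ∀ t : ℂ, f.1 (x + t • (y - x)) * g.1 (x + t • (y - x)) = 0 := fun t =>
      congrFun (congrArg Subtype.val hfg) _
    have hev : (fun t : ℂ => g.1 (x + t • (y - x))) =ᶠ[nhds 0] 0 := by
      have h0 : (fun t : ℂ => f.1 (x + t • (y - x))) 0 ≠ 0 := by simpa using hx
      filter_upwards [hfd.continuous.continuousAt.eventually_ne h0] with t ht
      exact (mul_eq_zero.1 (hprod t)).resolve_left ht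
    have hzero := AnalyticOnNhd.eq_of_eventuallyEq (𝕜 := ℂ)
      (fun t _ => hgd.analyticAt t) (fun t _ => analyticAt_const (v := (0 : ℂ))) hev
    have := congrFun hzero 1
    simp at this
    exact hy this
  exact NoZeroDivisors.to_isDomain _

/-- The field of meromorphic functions `f(P+h, P)`: on a finite-dimensional complex vector space
every meromorphic function is a quotient of two entire functions. -/
abbrev Mero (N : ℕ) : Type := FractionRing (entire N)

/-- The substitution `f(x, y) ↦ f(x + a, y + b)` on entire functions. -/
def shiftEntire {N : ℕ} (a b : W N) : entire N ≃+* entire N where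
  toFun f := ⟨fun z => f.1 (z.1 + a, z.2 + b), Differentiable.comp f.2 (by fun_prop)⟩
  invFun f := ⟨fun z => f.1 (z.1 - a, z.2 - b), Differentiable.comp f.2 (by fun_prop)⟩
  left_inv f := by ext z; simp
  right_inv f := by ext z; simp
  map_mul' f g := rfl
  map_add' f g := rfl

/-- The substitution `f(x, y) ↦ f(x + a, y + b)` on meromorphic functions. -/
def shiftMero {N : ℕ} (a b : W N) : Mero N ≃+* Mero N :=
  IsFractionRing.ringEquivOfRingEquiv (shiftEntire a b)

/-- The field of formal Laurent series in the indeterminate `ħ`. -/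
abbrev Kh : Type := ℂ⸨X⸩

/-- `q = e^ħ`. -/
def q : Kh := HahnSeries.ofPowerSeries ℤ ℂ (PowerSeries.exp ℂ)

/-- Functions of the dynamical parameters with scalars extended to Laurent series in `ħ`, so that
`q` and `q^{2P}`, `q^{2(P+h)}` make sense. -/
abbrev FF (N : ℕ) : Type := (Mero N)⸨X⸩

/-- A Laurent series in `ħ` as a constant function of the dynamical parameters. -/
def constFF (N : ℕ) (c : Kh) : FF N := HahnSeries.map c (algebraMap ℂ (Mero N))

/-- The substitution `f(x, y) ↦ f(x + a, y + b)`, coefficientwise in `ħ`. -/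
def shift {N : ℕ} (a b : W N) (f : FF N) : FF N := HahnSeries.map f (shiftMero a b)

/-- The linear function `h_{ε̄_l} = (P+h)_{ε̄_l} - P_{ε̄_l}`. -/
def hFun {N : ℕ} (l : Fin N) : entire N :=
  ⟨fun z => (z.1 : Fin N → ℂ) l - (z.2 : Fin N → ℂ) l, by
    have h : Differentiable ℂ fun w : W N => (w : Fin N → ℂ) l :=
      (LinearMap.toContinuousLinearMap
        ((LinearMap.proj l : (Fin N → ℂ) →ₗ[ℂ] ℂ) ∘ₗ (W N).subtype)).differentiable
    exact (h.comp differentiable_fst).sub (h.comp differentiable_snd)⟩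

/-- `q^{s h_{ε̄_l}} = ∑_n (s h_{ε̄_l})^n ħ^n / n!`. -/
def qPowH {N : ℕ} (s : ℂ) (l : Fin N) : FF N :=
  HahnSeries.ofPowerSeries ℤ (Mero N) (PowerSeries.mk fun n =>
    algebraMap (entire N) (Mero N) (((s ^ n / (n.factorial : ℂ)) : ℂ) • hFun l ^ n))

/-! ### Structure functions -/

/-- Scalars: Laurent polynomials over `ℂ((ħ))` in the central element `q^{c/2}`. -/
def B : Type := Kh[T;T⁻¹]

instance : CommRing B := inferInstanceAs (CommRing Kh[T;T⁻¹])

instance : Algebra Kh B := inferInstanceAs (Algebra Kh Kh[T;T⁻¹])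

instance : Algebra ℚ B := ((algebraMap Kh B).comp (algebraMap ℚ Kh)).toAlgebra

/-- `q^{m c / 2}`, the `m`-th power of the variable. -/
def gamB (m : ℤ) : B := (LaurentPolynomial.T m : Kh[T;T⁻¹])

/-- Formal power series in `p` over the scalars. -/
abbrev A : Type := B⟦X⟧

/-- `q^m`. -/
def qp (m : ℤ) : A := PowerSeries.C (algebraMap Kh B (q ^ m))

/-- `q^{m c / 2}`. -/
def gam (m : ℤ) : A := PowerSeries.C (gamB m)

/-- The elliptic nome `p`. -/
def p : A := PowerSeries.X

/-- `p* = p q^{-2c}`. -/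
def pStar : A := p * gam (-4)

/-- `(a x; t_1, …, t_k)_∞ = ∏_{n_1, …, n_k ≥ 0} (1 - a x t_1^{n_1} ⋯ t_k^{n_k})` as a power series
in `x`, that is `exp (- ∑_{n ≥ 1} (a x)^n / (n (1 - t_1^n) ⋯ (1 - t_k^n)))`. -/
def poch (a : A) (t : List A) : A⟦X⟧ :=
  (PowerSeries.exp A).subst (PowerSeries.mk fun n =>
    -(algebraMap ℚ A (1 / (n : ℚ)) * a ^ n * Ring.inverse (t.map fun s => 1 - s ^ n).prod))

/-- The quotient `f / g` of power series, where `g` has constant term `1`. -/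
def quo (f g : A⟦X⟧) : A⟦X⟧ := f * PowerSeries.invOfUnit g 1

/-- The value of a power series in `x` over formal power series in `p` at a point `a` divisible
by `p`. -/
def evalSmall (f : A⟦X⟧) (a : A) : A :=
  PowerSeries.mk fun m =>
    ∑ n ∈ Finset.range (m + 1), PowerSeries.coeff m (PowerSeries.coeff n f * a ^ n)

/-- `{a x} = (a x; p, q^{2N})_∞`. -/
def br (N : ℕ) (a : A) : A⟦X⟧ := poch a [p, qp (2 * N)]

/-- `{a x}* = (a x; p*, q^{2N})_∞`. -/
def brStar (N : ℕ) (a : A) : A⟦X⟧ := poch a [pStar, qp (2 * N)]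

/-- `ρ⁺₊(x)`. -/
def rhoPP (N : ℕ) : A⟦X⟧ :=
  quo (brStar N (qp 2) * brStar N (qp (2 * N - 2)) * br N 1 * br N (qp (2 * N)))
    (brStar N 1 * brStar N (qp (2 * N)) * br N (qp 2) * br N (qp (2 * N - 2)))

/-- `(p; p)_∞ (p* q²; p*)_∞ / ((p*; p*)_∞ (p q²; p)_∞)`. -/
def kappa : A :=
  evalSmall (poch 1 [p]) p * evalSmall (poch (qp 2) [pStar]) pStar *
    Ring.inverse (evalSmall (poch 1 [pStar]) pStar * evalSmall (poch (qp 2) [p]) p)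

/-! ### Generators, and formal series in spectral variables -/

/-- The symbols from which the algebra is generated: functions of the dynamical parameters, the
modes `e_{j,m}`, `f_{j,m}`, `k_{l,m}`, and the modes of the inverse of `k_l⁺(z)`. -/
inductive Gen (N : ℕ) : Type
  | fn (φ : FF N)
  | e (j : Fin (N - 1)) (m : ℤ)
  | f (j : Fin (N - 1)) (m : ℤ)
  | k (l : Fin N) (m : ℤ)
  | kinv (l : Fin N) (m : ℤ)

/-- The `p`-adic completion of the free algebra on the symbols: formal power series in the central
variable `p` over the free algebra. -/
abbrev Free (N : ℕ) : Type := (FreeAlgebra B (Gen N))⟦X⟧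

/-- A symbol as an element of the completed free algebra. -/
def sym {N : ℕ} (g : Gen N) : Free N := PowerSeries.C (FreeAlgebra.ι B g)

/-- A central scalar as an element of the completed free algebra. -/
def sc {N : ℕ} (a : A) : Free N := PowerSeries.map (algebraMap B (FreeAlgebra B (Gen N))) a

/-- The sum of a family that tends to zero `p`-adically (only finitely many members contribute to
the coefficient of each power of `p`). -/
def psum {N : ℕ} {ι : Type} (x : ι → Free N) : Free N :=
  PowerSeries.mk fun m => ∑ᶠ i, PowerSeries.coeff m (x i)

/-- A formal series `∑_n (a n) z^n`, infinite in both directions, given by its coefficients. -/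
abbrev Cur (N : ℕ) : Type := ℤ → Free N

variable {N : ℕ}

/-- The series `1`. -/
def oneCur : Cur N := fun n => if n = 0 then 1 else 0

/-- The product `a(z) b(z)`. -/
def conv (a b : Cur N) : Cur N := fun n => psum fun i : ℤ => a i * b (n - i)

/-- `a(q^m z)`. -/
def dil (m : ℤ) (a : Cur N) : Cur N := fun n => sc (qp (m * n)) * a n

/-- The coefficient of `z₁^r z₂^s` in `φ(z₂/z₁) a(z₁) b(z₂)`, with `φ` expanded in `z₂/z₁`. -/
def two (φ : A⟦X⟧) (a b : Cur N) (r s : ℤ) : Free N :=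
  psum fun n : ℕ => sc (PowerSeries.coeff n φ) * (a (r + n) * b (s - n))

/-- The coefficient of `z₁^r z₂^s z₃^t` in `φ₁₂(z₂/z₁) φ₁₃(z₃/z₁) φ₂₃(z₃/z₂) a(z₁) b(z₂) c(z₃)`. -/
def three (φ₁₂ φ₁₃ φ₂₃ : A⟦X⟧) (a b c : Cur N) (r s t : ℤ) : Free N :=
  psum fun n : ℕ × ℕ × ℕ =>
    sc (PowerSeries.coeff n.1 φ₁₂ * PowerSeries.coeff n.2.1 φ₁₃ * PowerSeries.coeff n.2.2 φ₂₃) *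
      (a (r + n.1 + n.2.1) * b (s - n.1 + n.2.2) * c (t - n.2.1 - n.2.2))

/-- `e_j(z) = ∑_m e_{j,m} z^{-m}`. -/
def eC (j : Fin (N - 1)) : Cur N := fun n => sym (.e j (-n))

/-- `f_j(z) = ∑_m f_{j,m} z^{-m}`. -/
def fC (j : Fin (N - 1)) : Cur N := fun n => sym (.f j (-n))

/-- `k_l⁺(z) = ∑_{m ≥ 0} k_{l,-m} z^m + ∑_{m > 0} k_{l,m} p^m z^{-m}`. -/
def kP (l : Fin N) : Cur N := fun n => sc (p ^ (-n).toNat) * sym (.k l (-n))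

/-- `k_l⁺(z)⁻¹`, a series of the same shape. -/
def kPinv (l : Fin N) : Cur N := fun n => sc (p ^ (-n).toNat) * sym (.kinv l (-n))

/-- `k_l⁻(z) = q^{2 h_{ε̄_l}} k_l⁺(z p* q^c)`, where `p* q^c = p q^{-c}`; the coefficient of `z^n`
is `q^{2 h_{ε̄_l}} q^{-cn} p^{max(n,0)} k_{l,-n}`. -/
def kM (l : Fin N) : Cur N := fun n =>
  sym (.fn (qPowH 2 l)) * (sc (gam (-2 * n) * p ^ n.toNat) * sym (.k l (-n)))

/-- `k_l⁻(z)⁻¹ = k_l⁺(z p* q^c)⁻¹ q^{-2 h_{ε̄_l}}`. -/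
def kMinv (l : Fin N) : Cur N := fun n =>
  (sc (gam (-2 * n) * p ^ n.toNat) * sym (.kinv l (-n))) * sym (.fn (qPowH (-2) l))

/-- `(a x; p*)_∞ / (b x; p*)_∞`. -/
def ratStar (a b : A) : A⟦X⟧ := quo (poch a [pStar]) (poch b [pStar])

/-- `(a x; p)_∞ / (b x; p)_∞`. -/
def rat (a b : A) : A⟦X⟧ := quo (poch a [p]) (poch b [p])

/-- The part of the Serre relation without the symmetrization: the coefficient of `z₁^r z₂^s w^t` in
`φ(z₂/z₁) { ψ(z₁/w) ψ(z₂/w) y(w) x(z₁) x(z₂) - [2]_q ψ(w/z₁) ψ(z₂/w) x(z₁) y(w) x(z₂)`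
`+ ψ(w/z₁) ψ(w/z₂) x(z₁) x(z₂) y(w) }`. -/
def serre (φ ψ : A⟦X⟧) (x y : Cur N) (r s t : ℤ) : Free N :=
  three ψ ψ φ y x x t r s - sc (qp 1 + qp (-1)) * three ψ φ ψ x y x r t s +
    three φ ψ ψ x x y r s t

/-! ### The algebra -/

/-- The defining relations, coefficient by coefficient in the spectral variables. -/
inductive Rel : Free N → Free N → Prop
  -- functions of the dynamical parameters form a subring containing the Laurent series in `ħ`
  | fn_add (φ ψ : FF N) : Rel (sym (.fn (φ + ψ))) (sym (.fn φ) + sym (.fn ψ))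
  | fn_mul (φ ψ : FF N) : Rel (sym (.fn (φ * ψ))) (sym (.fn φ) * sym (.fn ψ))
  | fn_const (c : Kh) :
      Rel (sym (.fn (constFF N c))) (sc (PowerSeries.C (algebraMap Kh B c)))
  -- the dynamical shifts
  | fn_e (φ : FF N) (j : Fin (N - 1)) (n : ℤ) :
      Rel (sym (.fn φ) * eC j n) (eC j n * sym (.fn (shift 0 (-alpha j) φ)))
  | fn_f (φ : FF N) (j : Fin (N - 1)) (n : ℤ) :
      Rel (sym (.fn φ) * fC j n) (fC j n * sym (.fn (shift (-alpha j) 0 φ)))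
  | fn_k (φ : FF N) (l : Fin N) (n : ℤ) :
      Rel (sym (.fn φ) * kP l n) (kP l n * sym (.fn (shift (-epsBar l) (-epsBar l) φ)))
  -- invertibility of `k_l⁺(z)`
  | k_kinv (l : Fin N) (n : ℤ) : Rel (conv (kP l) (kPinv l) n) (oneCur n)
  | kinv_k (l : Fin N) (n : ℤ) : Rel (conv (kPinv l) (kP l) n) (oneCur n)
  -- `k k`
  | k_k (l : Fin N) (r s : ℤ) :
      Rel (two (rhoPP N) (kP l) (kP l) r s) (two (rhoPP N) (kP l) (kP l) s r)
  | k_k' (j l : Fin N) (hjl : j < l) (r s : ℤ) :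
      Rel
        (two (rhoPP N * quo (poch pStar [pStar] * poch (p * qp 2) [p])
          (poch (pStar * qp 2) [pStar] * poch p [p])) (kP j) (kP l) r s)
        (two (rhoPP N * quo (poch (qp (-2)) [pStar] * poch 1 [p])
          (poch 1 [pStar] * poch (qp (-2)) [p])) (kP l) (kP j) s r)
  -- `k e`
  | k_e (j : Fin (N - 1)) (r s : ℤ) :
      Rel
        (two (ratStar (pStar * gam 2 * qp (2 - lab j)) (pStar * gam 2 * qp (-lab j)))
          (kP (lo j)) (eC j) r s)
        (sc (qp (-1)) * two (ratStar (gam (-2) * qp (lab j)) (gam (-2) * qp (-2 + lab j)))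
          (eC j) (kP (lo j)) s r)
  | k_e' (j : Fin (N - 1)) (r s : ℤ) :
      Rel
        (two (ratStar (pStar * gam 2 * qp (-2 - lab j)) (pStar * gam 2 * qp (-lab j)))
          (kP (hi j)) (eC j) r s)
        (sc (qp 1) * two (ratStar (gam (-2) * qp (lab j)) (gam (-2) * qp (2 + lab j)))
          (eC j) (kP (hi j)) s r)
  | k_e'' (l : Fin N) (j : Fin (N - 1)) (h₁ : l ≠ lo j) (h₂ : l ≠ hi j) (r s : ℤ) :
      Rel (kP l r * eC j s) (eC j s * kP l r)
  -- `k f`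
  | k_f (j : Fin (N - 1)) (r s : ℤ) :
      Rel
        (two (rat (p * qp (-lab j)) (p * qp (2 - lab j))) (kP (lo j)) (fC j) r s)
        (sc (qp 1) * two (rat (qp (-2 + lab j)) (qp (lab j))) (fC j) (kP (lo j)) s r)
  | k_f' (j : Fin (N - 1)) (r s : ℤ) :
      Rel
        (two (rat (p * qp (-lab j)) (p * qp (-2 - lab j))) (kP (hi j)) (fC j) r s)
        (sc (qp (-1)) * two (rat (qp (2 + lab j)) (qp (lab j))) (fC j) (kP (hi j)) s r)
  | k_f'' (l : Fin N) (j : Fin (N - 1)) (h₁ : l ≠ lo j) (h₂ : l ≠ hi j) (r s : ℤ) :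
      Rel (kP l r * fC j s) (fC j s * kP l r)
  -- `e e`: the factors `z₁` and `z₂` lower the exponents by one
  | e_e (j : Fin (N - 1)) (r s : ℤ) :
      Rel (two (ratStar (qp 2) (pStar * qp (-2))) (eC j) (eC j) (r - 1) s)
        (-two (ratStar (qp 2) (pStar * qp (-2))) (eC j) (eC j) (s - 1) r)
  | e_e' (j l : Fin (N - 1)) (hjl : l.1 = j.1 + 1) (r s : ℤ) :
      Rel (two (ratStar (qp (-1)) (pStar * qp 1)) (eC j) (eC l) (r - 1) s)
        (-two (ratStar (qp (-1)) (pStar * qp 1)) (eC l) (eC j) (s - 1) r)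
  | e_e'' (j l : Fin (N - 1)) (hjl : 1 < |lab j - lab l|) (r s : ℤ) :
      Rel (eC j r * eC l s) (eC l s * eC j r)
  -- `f f`
  | f_f (j : Fin (N - 1)) (r s : ℤ) :
      Rel (two (rat (qp (-2)) (p * qp 2)) (fC j) (fC j) (r - 1) s)
        (-two (rat (qp (-2)) (p * qp 2)) (fC j) (fC j) (s - 1) r)
  | f_f' (j l : Fin (N - 1)) (hjl : l.1 = j.1 + 1) (r s : ℤ) :
      Rel (two (rat (qp 1) (p * qp (-1))) (fC j) (fC l) (r - 1) s)
        (-two (rat (qp 1) (p * qp (-1))) (fC l) (fC j) (s - 1) r)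
  | f_f'' (j l : Fin (N - 1)) (hjl : 1 < |lab j - lab l|) (r s : ℤ) :
      Rel (fC j r * fC l s) (fC l s * fC j r)
  -- `[e_i(z₁), f_j(z₂)]`: `δ(q^{-c} z₁/z₂) g(z₁)` has the coefficient `q^{cs} g_{r+s}` at
  -- `z₁^r z₂^s`, and `δ(q^c z₁/z₂) g(z₂)` has the coefficient `q^{cr} g_{r+s}`
  | e_f (i j : Fin (N - 1)) (hij : i ≠ j) (r s : ℤ) : Rel (eC i r * fC j s) (fC j s * eC i r)
  | e_f' (j : Fin (N - 1)) (r s : ℤ) :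
      Rel (eC j r * fC j s - fC j s * eC j r)
        (sc (kappa * PowerSeries.C (algebraMap Kh B (q - q⁻¹)⁻¹)) *
          (sc (gam (2 * s)) * dil (-lab j) (conv (kM (lo j)) (kMinv (hi j))) (r + s) -
            sc (gam (2 * r)) * dil (-lab j) (conv (kP (lo j)) (kPinv (hi j))) (r + s)))
  -- the Serre relations, symmetrized in `z₁ ↔ z₂`
  | serre_e (i j : Fin (N - 1)) (hij : |lab i - lab j| = 1) (r s t : ℤ) :
      Rel
        (serre (ratStar (pStar * qp 2) (pStar * qp (-2))) (ratStar (pStar * qp (-1)) (pStar * qp 1))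
            (eC i) (eC j) r s t +
          serre (ratStar (pStar * qp 2) (pStar * qp (-2)))
            (ratStar (pStar * qp (-1)) (pStar * qp 1)) (eC i) (eC j) s r t) 0
  | serre_f (i j : Fin (N - 1)) (hij : |lab i - lab j| = 1) (r s t : ℤ) :
      Rel
        (serre (rat (p * qp (-2)) (p * qp 2)) (rat (p * qp 1) (p * qp (-1)))
            (fC i) (fC j) r s t +
          serre (rat (p * qp (-2)) (p * qp 2)) (rat (p * qp 1) (p * qp (-1)))
            (fC i) (fC j) s r t) 0

/-- A two-sided ideal is `p`-adically closed: it contains every element that lies in `J + p^n Free`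
for all `n`. -/
def IsPClosed (J : TwoSidedIdeal (Free N)) : Prop :=
  ∀ x : Free N, (∀ n : ℕ, ∃ y : Free N, x - sc (p ^ n) * y ∈ J) → x ∈ J

/-- The quotient by `J` has no `p`-torsion. -/
def IsPSaturated (J : TwoSidedIdeal (Free N)) : Prop :=
  ∀ x : Free N, sc p * x ∈ J → x ∈ J

variable (N) in
/-- The ideal of relations: the smallest two-sided ideal that contains the defining relations, is
`p`-adically closed, and has a `p`-torsion-free quotient. -/
def relIdeal : TwoSidedIdeal (Free N) :=
  sInf {J | (∀ x y : Free N, Rel x y → x - y ∈ J) ∧ IsPClosed J ∧ IsPSaturated J}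

variable (N) in
/-- The elliptic algebra `U'_{q,p}(gl_N^)`: the `p`-adically complete, `p`-torsion-free algebra
with the above generators and relations. -/
abbrev UPrime : Type := (relIdeal N).ringCon.Quotient

/-- The class of an element of the completed free algebra. -/
def toU : Free N →+* UPrime N := (relIdeal N).ringCon.mk'

variable (N) in
/-- The coefficients of `k_1⁺(z) k_2⁺(q^{-2} z) ⋯ k_N⁺(q^{-2(N-1)} z)` in the completed free
algebra. -/
def kProd : Cur N :=
  (List.ofFn fun l : Fin N => dil (-2 * (l.1 : ℤ)) (kP l)).foldr conv oneCur

variable (N) in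
/-- The coefficient of `z^n` in `K(z) = k_1⁺(z) k_2⁺(q^{-2} z) ⋯ k_N⁺(q^{-2(N-1)} z)`. -/
def KCoeff (n : ℤ) : UPrime N := toU (kProd N n)

end EllipticGL

end

noncomputable section

namespace EllipticGL

/-! ### Exponentials of formal power series without constant term -/

section ExpSubst

open PowerSeries

variable {R : Type*} [CommRing R] [Algebra ℚ R]

/-! Every relation between `k_l⁺(z₁)` and a current `b(z₂)` among the `e_j`, `f_j`, `k_j⁺` has the
form `φ_l(z₂/z₁) k_l⁺(z₁) b(z₂) = ψ_l(z₁/z₂) b(z₂) k_l⁺(z₁)`. Moving `b(z₂)` through all factors of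
`K(z₁)` therefore produces the product of the `φ_l`, with arguments dilated by `q^{2(l-1)}`, on one
side and the product of the `ψ_l`, dilated by `q^{-2(l-1)}`, on the other. Both products are `1`.

For `e_j` and `f_j` only `l = j, j+1` contribute. The relative dilation by `q^{±2}` makes their two
functions inverse to each other, and the prefactors `q` and `q⁻¹` cancel
(`KillsP.commute_kProd_of_adjacent`). For `k_l⁺` all `N` factors contribute; the logarithms of the
structure functions have a common factor, and what remains is a geometric sum that vanishes
(`geom_total`, `prod_kkLeft`, `prod_kkRight`). A function of `(P+h, P)` is shifted in total by `∑
ε̄_l = 0` (`sum_epsBar`).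

The delicate point is that the two sides are expanded in opposite directions, so such relations
cannot be multiplied naively. Modulo `p^m` this is harmless: the coefficient of `x^n` in `φ_l` is
divisible by `p^n`, so `φ_l` becomes a polynomial, and `k_l⁺` keeps finitely many negative powers.
Each relation becomes an equality of two Laurent series in `z₁`, with operator coefficients, applied
to the coefficient sequence of `b`. Left and right multiplications commute as operators, so the
relations can be multiplied (`AgreeAt.list_prod`, `KillsP.commute_foldr`). Closedness of the ideal
passes from all `p^m` to the algebra, and the absence of `p`-torsion recovers `k_{l,m}` from `p^m
k_{l,m}`. -/

theorem constantCoeff_exp_subst {f : R⟦X⟧} (hf : constantCoeff f = 0) :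
    constantCoeff ((exp R).subst f) = 1 := by
  have h : (exp R) = C (1 : R) + (exp R - 1) := by simp
  have hs : HasSubst f := HasSubst.of_constantCoeff_zero' hf
  rw [h, subst_add hs, map_add]
  have h2 := constantCoeff_subst_eq_zero (a := f) hf (exp R - 1) (by simp)
  have h3 : (C (1 : R)).subst f = 1 := by
    rw [subst_C]; simp
  rw [h3]
  have h4 : constantCoeff (PowerSeries.subst f (exp R - 1)) = 0 := h2
  rw [h4]; simp

theorem derivative_exp_subst {f : R⟦X⟧} (hf : constantCoeff f = 0) :
    derivative R ((exp R).subst f) = (exp R).subst f * derivative R f := by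
  rw [derivative_subst (HasSubst.of_constantCoeff_zero' hf), derivative_exp]

/-- The derivative of the product vanishes by the Leibniz rule, and over a `ℚ`-algebra a power
series is determined by its derivative and its constant term. -/
theorem exp_subst_mul_neg {f : R⟦X⟧} (hf : constantCoeff f = 0) :
    (exp R).subst f * (exp R).subst (-f) = 1 := by
  have : IsAddTorsionFree R := IsAddTorsionFree.of_module_rat R
  have hf' : constantCoeff (-f) = 0 := by simp [hf]
  refine derivative.ext ?_ ?_
  · rw [Derivation.leibniz, derivative_exp_subst hf, derivative_exp_subst hf']
    simp only [smul_eq_mul, map_neg, Derivation.map_one_eq_zero]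
    ring
  · simp [constantCoeff_exp_subst hf, constantCoeff_exp_subst hf']

/-- The derivative argument shows that `exp(f + g) exp(-f) exp(-g) = 1`; multiplying by `exp f` and
`exp g` gives the claim. -/
theorem exp_subst_add {f g : R⟦X⟧} (hf : constantCoeff f = 0) (hg : constantCoeff g = 0) :
    (exp R).subst (f + g) = (exp R).subst f * (exp R).subst g := by
  have : IsAddTorsionFree R := IsAddTorsionFree.of_module_rat R
  have hf' : constantCoeff (-f) = 0 := by simp [hf]
  have hg' : constantCoeff (-g) = 0 := by simp [hg]
  have hfg : constantCoeff (f + g) = 0 := by simp [hf, hg]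
  have h : (exp R).subst (f + g) * ((exp R).subst (-f) * (exp R).subst (-g)) = 1 := by
    refine derivative.ext ?_ ?_
    · rw [Derivation.leibniz, Derivation.leibniz, derivative_exp_subst hfg,
        derivative_exp_subst hf', derivative_exp_subst hg']
      simp only [smul_eq_mul, map_neg, map_add, Derivation.map_one_eq_zero]
      ring
    · simp [constantCoeff_exp_subst hfg, constantCoeff_exp_subst hf', constantCoeff_exp_subst hg']
  have h1 := exp_subst_mul_neg hf
  have h2 := exp_subst_mul_neg hg
  calc (exp R).subst (f + g)
      = (exp R).subst (f + g) * ((exp R).subst f * (exp R).subst (-f)) *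
          ((exp R).subst g * (exp R).subst (-g)) := by rw [h1, h2]; ring
    _ = (exp R).subst (f + g) * ((exp R).subst (-f) * (exp R).subst (-g)) *
          ((exp R).subst f * (exp R).subst g) := by ring
    _ = _ := by rw [h, one_mul]

theorem rescale_exp_subst (c : R) {f : R⟦X⟧} (hf : constantCoeff f = 0) :
    rescale c ((exp R).subst f) = (exp R).subst (rescale c f) := by
  rw [rescale_eq_subst, rescale_eq_subst,
    subst_comp_subst_apply (HasSubst.of_constantCoeff_zero' hf) (HasSubst.smul_X' c)]

theorem exp_subst_zero : (exp R).subst (0 : R⟦X⟧) = 1 := by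
  have h := exp_subst_mul_neg (R := R) (f := 0) (by simp)
  have h2 := exp_subst_add (R := R) (f := 0) (g := 0) (by simp) (by simp)
  rw [neg_zero] at h
  rw [add_zero] at h2
  rw [h2, h]

end ExpSubst

/-! ### Infinite products as exponentials, and divisibility of their coefficients by powers of `p`
-/

section Poch

open PowerSeries

/-- The exponent of `poch a t`. -/
def pochExponent (a : A) (t : List A) : A⟦X⟧ :=
  PowerSeries.mk fun n =>
    -(algebraMap ℚ A (1 / (n : ℚ)) * a ^ n * Ring.inverse (t.map fun s => 1 - s ^ n).prod)

theorem poch_eq (a : A) (t : List A) : poch a t = (exp A).subst (pochExponent a t) := rfl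

theorem constantCoeff_pochExponent (a : A) (t : List A) :
    constantCoeff (pochExponent a t) = 0 := by
  rw [← coeff_zero_eq_constantCoeff_apply, pochExponent, coeff_mk]
  simp

theorem rescale_pochExponent (c a : A) (t : List A) :
    rescale c (pochExponent a t) = pochExponent (c * a) t := by
  ext1 n
  simp only [coeff_rescale, pochExponent, coeff_mk]
  ring

theorem quo_exp_subst {f g : A⟦X⟧} (hf : constantCoeff f = 0) (hg : constantCoeff g = 0) :
    quo ((exp A).subst f) ((exp A).subst g) = (exp A).subst (f - g) := by
  have hg' : constantCoeff (-g) = 0 := by simp [hg]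
  have h : (exp A).subst g * invOfUnit ((exp A).subst g) 1 = 1 :=
    mul_invOfUnit _ 1 (by simpa using constantCoeff_exp_subst hg)
  have h1 := exp_subst_mul_neg hg
  have h2 : invOfUnit ((exp A).subst g) 1 = (exp A).subst (-g) := by
    calc invOfUnit ((exp A).subst g) 1
        = ((exp A).subst g * (exp A).subst (-g)) * invOfUnit ((exp A).subst g) 1 := by
          rw [h1, one_mul]
      _ = (exp A).subst (-g) * ((exp A).subst g * invOfUnit ((exp A).subst g) 1) := by ring
      _ = _ := by rw [h, mul_one]
  rw [quo, h2, sub_eq_add_neg, exp_subst_add hf hg']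

theorem quo_poch (a b : A) (t : List A) :
    quo (poch a t) (poch b t) = (exp A).subst (pochExponent a t - pochExponent b t) :=
  quo_exp_subst (constantCoeff_pochExponent a t) (constantCoeff_pochExponent b t)

/-- This is how the dilations in `K(z)` act: they move into the parameters of the infinite products.
-/
theorem rescale_quo_poch (c a b : A) (t : List A) :
    rescale c (quo (poch a t) (poch b t)) = quo (poch (c * a) t) (poch (c * b) t) := by
  rw [quo_poch, quo_poch, rescale_exp_subst, map_sub, rescale_pochExponent, rescale_pochExponent]
  simp [constantCoeff_pochExponent]

theorem quo_poch_mul_quo_poch (a b : A) (t : List A) :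
    quo (poch a t) (poch b t) * quo (poch b t) (poch a t) = 1 := by
  rw [quo_poch, quo_poch, ← exp_subst_add, ← exp_subst_zero]
  · congr 1; ring
  · simp [constantCoeff_pochExponent]
  · simp [constantCoeff_pochExponent]

/-- The coefficient of `x^n` is divisible by `p^n`. -/
def IsSmall (φ : A⟦X⟧) : Prop := ∀ n, p ^ n ∣ coeff n φ

theorem isSmall_rescale (a : A) (φ : A⟦X⟧) : IsSmall (rescale (p * a) φ) := fun n => by
  rw [coeff_rescale, mul_pow, mul_assoc]
  exact dvd_mul_right _ _

theorem IsSmall.rescale {φ : A⟦X⟧} (h : IsSmall φ) (c : A) :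
    IsSmall (PowerSeries.rescale c φ) := fun n => by
  rw [coeff_rescale]
  exact (h n).mul_left _

theorem isSmall_one : IsSmall 1 := fun n => by
  rw [coeff_one]
  split_ifs with h
  · simp [h]
  · exact dvd_zero _

/-- The common factor `p` of both parameters can be moved into the variable, and substituting `p x`
for `x` multiplies the `n`-th coefficient by `p^n`. -/
theorem isSmall_quo_poch (a b : A) (t : List A) :
    IsSmall (quo (poch (p * a) t) (poch (p * b) t)) := by
  have h := rescale_quo_poch (p * 1) a b t
  rw [mul_one] at h
  rw [← h]
  simpa using isSmall_rescale 1 (quo (poch a t) (poch b t))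

/-! ### Units in the ring of scalars -/

theorem q_pow (k : ℕ) :
    q ^ k = HahnSeries.ofPowerSeries ℤ ℂ (rescale (k : ℂ) (exp ℂ)) := by
  rw [q, ← map_pow, exp_pow_eq_rescale_exp]

theorem q_ne_zero : q ≠ 0 := by
  intro h
  have h1 : q.coeff (0 : ℕ) = 1 := by
    rw [q, HahnSeries.ofPowerSeries_apply_coeff]
    simp
  rw [h] at h1
  simp at h1

/-- The coefficient of `ħ` in `q^k = e^{kħ}` is `k`. -/
theorem q_pow_ne_one {k : ℕ} (hk : k ≠ 0) : q ^ k ≠ 1 := by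
  intro h
  have h1 : (q ^ k).coeff (1 : ℕ) = k := by
    rw [q_pow, HahnSeries.ofPowerSeries_apply_coeff, coeff_rescale]
    simp
  rw [h] at h1
  have : ((1 : Kh).coeff ((1 : ℕ) : ℤ)) = 0 := by
    rw [HahnSeries.coeff_one]; simp
  rw [this] at h1
  exact hk (by exact_mod_cast h1.symm)

theorem qp_add (m n : ℤ) : qp (m + n) = qp m * qp n := by
  rw [qp, zpow_add₀ q_ne_zero, map_mul, map_mul]; rfl

theorem qp_zero : qp 0 = 1 := by simp [qp]

theorem qp_pow (m : ℤ) (n : ℕ) : qp m ^ n = qp (m * n) := by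
  rw [qp, qp, ← map_pow, ← map_pow, zpow_mul, zpow_natCast]

/-- Since `q` is not a root of unity, `1 - q^k` is nonzero in the field `Kh`. Invertibility matters
because `Ring.inverse` is `0` at a non-unit. -/
theorem isUnit_one_sub_qp {k : ℤ} (hk : k ≠ 0) : IsUnit (1 - qp k) := by
  have : (1 : A) - qp k = ((PowerSeries.C (R := B)).comp (algebraMap Kh B)) (1 - q ^ k) := by
    rw [map_sub, map_one]; rfl
  rw [this]
  refine IsUnit.map _ (isUnit_iff_ne_zero.2 ?_)
  rw [sub_ne_zero]
  intro h
  rcases Int.natAbs_eq k with h' | h'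
  · rw [h', zpow_natCast] at h
    exact q_pow_ne_one (by omega) h.symm
  · rw [h', zpow_neg, zpow_natCast, eq_comm, inv_eq_one] at h
    exact q_pow_ne_one (by omega) h

theorem isUnit_one_sub_p_mul_pow (a : A) {n : ℕ} (hn : n ≠ 0) : IsUnit (1 - (p * a) ^ n) := by
  rw [PowerSeries.isUnit_iff_constantCoeff]
  have : constantCoeff p = 0 := PowerSeries.constantCoeff_X
  simp [this, hn]

/-! ### The structure functions of the `k k` relations -/

/-- `1 / (1 - p^n) - 1 / (1 - p*^n)`. -/
def nomeDiff (n : ℕ) : A := Ring.inverse (1 - p ^ n) - Ring.inverse (1 - pStar ^ n)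

/-- The exponential of `- ∑_{n ≥ 1} (1 / (1 - p^n) - 1 / (1 - p*^n)) g_n x^n / n`. -/
def nomeExp (g : ℕ → A) : A⟦X⟧ :=
  (exp A).subst (PowerSeries.mk fun n => -(algebraMap ℚ A (1 / (n : ℚ)) * nomeDiff n * g n))

theorem constantCoeff_nomeExp_exponent (g : ℕ → A) : constantCoeff (PowerSeries.mk fun n =>
    -(algebraMap ℚ A (1 / (n : ℚ)) * nomeDiff n * g n)) = 0 := by
  rw [← coeff_zero_eq_constantCoeff_apply, coeff_mk]
  simp

theorem nomeExp_add (g g' : ℕ → A) : nomeExp (g + g') = nomeExp g * nomeExp g' := by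
  rw [nomeExp, nomeExp, nomeExp, ← exp_subst_add (constantCoeff_nomeExp_exponent g)
    (constantCoeff_nomeExp_exponent g')]
  congr 1
  ext1 n
  simp only [map_add, coeff_mk, Pi.add_apply]
  ring

theorem rescale_nomeExp (c : A) (g : ℕ → A) :
    rescale c (nomeExp g) = nomeExp fun n => c ^ n * g n := by
  rw [nomeExp, nomeExp, rescale_exp_subst _ (constantCoeff_nomeExp_exponent g)]
  congr 1
  ext1 n
  simp only [coeff_rescale, coeff_mk]
  ring

theorem nomeExp_congr {g g' : ℕ → A} (h : ∀ n ≠ 0, g n = g' n) : nomeExp g = nomeExp g' := by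
  rw [nomeExp, nomeExp]
  congr 1
  ext1 n
  simp only [coeff_mk]
  rcases eq_or_ne n 0 with rfl | hn
  · simp
  · rw [h n hn]

theorem nomeExp_eq_one {g : ℕ → A} (h : ∀ n ≠ 0, g n = 0) : nomeExp g = 1 := by
  rw [nomeExp_congr (g' := 0) h, ← exp_subst_zero, nomeExp]
  congr 1
  ext1 n
  simp

/-- Over the common denominator, `1/(1 - p^n) - 1/(1 - p*^n)` has numerator `p^n - p*^n = p^n (1 -
q^{-2cn})`. The factor `p^n` in the exponent amounts to substituting `p x` for `x`. -/
theorem isSmall_nomeExp (g : ℕ → A) : IsSmall (nomeExp g) := by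
  have h : nomeExp g = rescale (p * 1) ((exp A).subst (PowerSeries.mk fun n =>
      -(algebraMap ℚ A (1 / (n : ℚ)) * ((1 - gam (-4) ^ n) * Ring.inverse (1 - p ^ n) *
        Ring.inverse (1 - pStar ^ n)) * g n))) := by
    rw [rescale_exp_subst, nomeExp]
    · congr 1
      ext1 n
      simp only [coeff_rescale, coeff_mk]
      rcases eq_or_ne n 0 with rfl | hn
      · simp
      · have h1 : (1 - p ^ n) * Ring.inverse (1 - p ^ n) = 1 :=
          Ring.mul_inverse_cancel _ (by simpa using isUnit_one_sub_p_mul_pow 1 hn)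
        have h2 : (1 - pStar ^ n) * Ring.inverse (1 - pStar ^ n) = 1 :=
          Ring.mul_inverse_cancel _ (isUnit_one_sub_p_mul_pow _ hn)
        have h3 : nomeDiff n = p ^ n * ((1 - gam (-4) ^ n) * Ring.inverse (1 - p ^ n) *
            Ring.inverse (1 - pStar ^ n)) := by
          have h4 : pStar ^ n = p ^ n * gam (-4) ^ n := mul_pow _ _ _
          rw [nomeDiff]
          rw [h4] at h2 ⊢
          linear_combination (-Ring.inverse (1 - p ^ n)) * h2 +
            (Ring.inverse (1 - p ^ n * gam (-4) ^ n)) * h1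
        rw [h3]
        ring
    · rw [← coeff_zero_eq_constantCoeff_apply, coeff_mk]
      simp
  rw [h]
  exact isSmall_rescale _ _

end Poch
-- Cancellation of the `k k` structure functions over the whole product
section KK

open PowerSeries

/-- `(1 - q^{2n}) (1 - q^{2(N-1)n}) / (1 - q^{2Nn})`. -/
def rhoExponent (N n : ℕ) : A :=
  (1 - qp 2 ^ n) * (1 - qp (2 * N - 2) ^ n) * Ring.inverse (1 - qp (2 * N) ^ n)

theorem coeff_pochExponent (a : A) (t : List A) (n : ℕ) : coeff n (pochExponent a t) =
    -(algebraMap ℚ A (1 / (n : ℚ)) * a ^ n * Ring.inverse (t.map fun s => 1 - s ^ n).prod) := by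
  rw [pochExponent, coeff_mk]

theorem qp_two_mul_pow (N n : ℕ) : qp (2 * N) ^ n = qp 2 ^ n * qp (2 * N - 2) ^ n := by
  rw [← mul_pow, ← qp_add]
  congr 2
  ring

/-- The four factors with the same nome contribute `1 - q^{2n} - q^{(2N-2)n} + q^{2Nn}`, which
factors as `(1 - q^{2n})(1 - q^{(2N-2)n})`; the nomes `p` and `p*` enter with opposite signs. -/
theorem rhoPP_eq (N : ℕ) : rhoPP N = nomeExp (rhoExponent N) := by
  simp only [rhoPP, br, brStar, poch_eq]
  rw [← exp_subst_add, ← exp_subst_add, ← exp_subst_add, ← exp_subst_add, ← exp_subst_add,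
    ← exp_subst_add, quo_exp_subst, nomeExp]
  · congr 1
    ext1 n
    simp only [map_add, map_sub, coeff_mk, coeff_pochExponent, List.map_cons, List.map_nil,
      List.prod_cons, List.prod_nil, mul_one, Ring.mul_inverse_rev, nomeDiff, rhoExponent,
      one_pow, qp_two_mul_pow]
    ring
  all_goals simp [constantCoeff_pochExponent]

/-- Since `p^n/(1 - p^n) = 1/(1 - p^n) - 1`, and likewise for `p*`, the extra factors of the nome
contribute constants that cancel in the difference. -/
theorem nomeExp_eq_left : quo (poch pStar [pStar] * poch (p * qp 2) [p])
    (poch (pStar * qp 2) [pStar] * poch p [p]) = nomeExp fun n => qp 2 ^ n - 1 := by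
  simp only [poch_eq]
  rw [← exp_subst_add, ← exp_subst_add, quo_exp_subst, nomeExp]
  · congr 1
    ext1 n
    simp only [map_add, map_sub, coeff_mk, coeff_pochExponent, List.map_cons, List.map_nil,
      List.prod_cons, List.prod_nil, mul_one, nomeDiff, mul_pow]
    rcases eq_or_ne n 0 with rfl | hn
    · simp
    · have h1 : (1 - p ^ n) * Ring.inverse (1 - p ^ n) = 1 :=
        Ring.mul_inverse_cancel _ (by simpa using isUnit_one_sub_p_mul_pow 1 hn)
      have h2 : (1 - pStar ^ n) * Ring.inverse (1 - pStar ^ n) = 1 :=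
        Ring.mul_inverse_cancel _ (isUnit_one_sub_p_mul_pow _ hn)
      linear_combination algebraMap ℚ A (1 / (n : ℚ)) * (1 - qp 2 ^ n) * (h2 - h1)
  all_goals simp [constantCoeff_pochExponent]

theorem nomeExp_eq_right : quo (poch (qp (-2)) [pStar] * poch 1 [p])
    (poch 1 [pStar] * poch (qp (-2)) [p]) = nomeExp fun n => 1 - qp (-2) ^ n := by
  simp only [poch_eq]
  rw [← exp_subst_add, ← exp_subst_add, quo_exp_subst, nomeExp]
  · congr 1
    ext1 n
    simp only [map_add, map_sub, coeff_mk, coeff_pochExponent, List.map_cons, List.map_nil,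
      List.prod_cons, List.prod_nil, mul_one, nomeDiff, one_pow]
    ring
  all_goals simp [constantCoeff_pochExponent]

/-- The structure function of `k_j k_l` in the relation with `k_j⁺(z₁) k_l⁺(z₂)` on the left,
expanded in `z₂ / z₁`. -/
def kkLeft (N : ℕ) (j l : ℕ) : A⟦X⟧ :=
  nomeExp fun n => rhoExponent N n +
    if j < l then qp 2 ^ n - 1 else if j = l then 0 else 1 - qp (-2) ^ n

/-- The structure function of `k_l k_j` in the relation with `k_j⁺(z₁) k_l⁺(z₂)` on the left,
expanded in `z₁ / z₂`. -/
def kkRight (N : ℕ) (j l : ℕ) : A⟦X⟧ :=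
  nomeExp fun n => rhoExponent N n +
    if j < l then 1 - qp (-2) ^ n else if j = l then 0 else qp 2 ^ n - 1

/-- The sum telescopes. The summand is the increment of the sequence equal to `Q^j` for `j ≤ l` and
to `S Q^j` for `j > l`; the step from `l` to `l + 1` is zero because `S Q = 1`. -/
theorem geom_telescope {R : Type*} [CommRing R] (Q S : R) (hQS : Q * S = 1) (N l : ℕ)
    (hl : l < N) :
    ∑ j ∈ Finset.range N, Q ^ j * (if j < l then Q - 1 else if j = l then 0 else 1 - S) =
      S * Q ^ N - 1 := by
  have h : ∀ j ∈ Finset.range N,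
      Q ^ j * (if j < l then Q - 1 else if j = l then 0 else 1 - S) =
        (fun j => if j ≤ l then Q ^ j else S * Q ^ j) (j + 1) -
          (fun j => if j ≤ l then Q ^ j else S * Q ^ j) j := by
    intro j _
    rcases lt_trichotomy j l with h | h | h
    · simp only [h, h.le, Nat.succ_le_of_lt h, if_true]
      ring
    · subst h
      simp only [lt_irrefl, if_false, if_true, le_refl, Nat.not_succ_le_self]
      linear_combination (-Q ^ j) * hQS
    · have h1 : ¬ j < l := by omega
      have h2 : ¬ j = l := by omega
      have h3 : ¬ j ≤ l := by omega
      have h4 : ¬ j + 1 ≤ l := by omega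
      simp only [h1, h2, h3, h4, if_false]
      linear_combination (-Q ^ j) * hQS
  rw [Finset.sum_congr rfl h,
    Finset.sum_range_sub fun j => if j ≤ l then Q ^ j else S * Q ^ j]
  have h1 : ¬ N ≤ l := by omega
  simp [h1]

/-- The common term sums to `1 - S Q^N`, because `(1 - Q) ∑ Q^j = 1 - Q^N` cancels against `I`. This
is the negative of the telescoping sum. -/
theorem geom_total {R : Type*} [CommRing R] (Q S I : R) (hQS : Q * S = 1) (N l : ℕ)
    (hI : (1 - Q ^ N) * I = 1) (hl : l < N) :
    ∑ j ∈ Finset.range N, Q ^ j * ((1 - Q) * (1 - S * Q ^ N) * I +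
      if j < l then Q - 1 else if j = l then 0 else 1 - S) = 0 := by
  simp only [mul_add, Finset.sum_add_distrib]
  rw [geom_telescope Q S hQS N l hl, ← Finset.sum_mul]
  have h := mul_neg_geom_sum Q N
  linear_combination ((1 - S * Q ^ N) * I) * h + (1 - S * Q ^ N) * hI

theorem list_prod_nomeExp {ι : Type*} (L : List ι) (g : ι → ℕ → A) :
    (L.map fun i => nomeExp (g i)).prod = nomeExp fun n => (L.map fun i => g i n).sum := by
  induction L with
  | nil => simpa using (nomeExp_eq_one (fun _ _ => rfl)).symm
  | cons i L ih =>
    rw [List.map_cons, List.prod_cons, ih, ← nomeExp_add]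
    simp only [List.map_cons, List.sum_cons]
    rfl

theorem qp_mul_natCast_pow (m : ℤ) (j n : ℕ) : qp (m * j) ^ n = (qp m ^ n) ^ j := by
  rw [qp_pow, qp_pow, qp_pow]
  congr 1
  ring

theorem qp_two_mul_qp_neg_two (n : ℕ) : qp 2 ^ n * qp (-2) ^ n = 1 := by
  rw [← mul_pow, ← qp_add]
  simp [qp_zero]

theorem isUnit_one_sub_qp_pow (N n : ℕ) (hN : N ≠ 0) (hn : n ≠ 0) :
    IsUnit (1 - (qp 2 ^ n) ^ N) := by
  rw [qp_pow, qp_pow]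
  apply isUnit_one_sub_qp
  positivity

theorem rhoExponent_eq (N n : ℕ) : rhoExponent N n = (1 - qp 2 ^ n) *
    (1 - qp (-2) ^ n * (qp 2 ^ n) ^ N) * Ring.inverse (1 - (qp 2 ^ n) ^ N) := by
  have h : qp (2 * N - 2) ^ n = qp (-2) ^ n * (qp 2 ^ n) ^ N := by
    rw [← qp_mul_natCast_pow, ← mul_pow, ← qp_add]
    congr 2
  rw [rhoExponent, h, qp_mul_natCast_pow]

theorem prod_kkLeft (N : ℕ) (l : Fin N) :
    ((List.finRange N).map fun j : Fin N => rescale (qp (2 * (j.1 : ℤ))) (kkLeft N j.1 l.1)).prod =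
      1 := by
  simp only [kkLeft, rescale_nomeExp]
  rw [list_prod_nomeExp]
  refine nomeExp_eq_one fun n hn => ?_
  rw [← List.ofFn_eq_map, List.sum_ofFn, Fin.sum_univ_eq_sum_range (fun j : ℕ => qp (2 * (j : ℤ)) ^ n *
    (rhoExponent N n + if j < l then qp 2 ^ n - 1 else if j = l then 0 else 1 - qp (-2) ^ n)) N]
  simp only [rhoExponent_eq, qp_mul_natCast_pow]
  exact geom_total _ _ _ (qp_two_mul_qp_neg_two n) N l
    (Ring.mul_inverse_cancel _ (isUnit_one_sub_qp_pow N n l.pos.ne' hn)) l.2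

theorem prod_kkRight (N : ℕ) (l : Fin N) :
    ((List.finRange N).map fun j : Fin N =>
      rescale (qp (-2 * (j.1 : ℤ))) (kkRight N j.1 l.1)).prod = 1 := by
  simp only [kkRight, rescale_nomeExp]
  rw [list_prod_nomeExp]
  refine nomeExp_eq_one fun n hn => ?_
  rw [← List.ofFn_eq_map, List.sum_ofFn, Fin.sum_univ_eq_sum_range (fun j : ℕ => qp (-2 * (j : ℤ)) ^ n *
    (rhoExponent N n + if j < l then 1 - qp (-2) ^ n else if j = l then 0 else qp 2 ^ n - 1)) N]
  simp only [rhoExponent_eq, qp_mul_natCast_pow]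
  set Q := qp 2 ^ n
  set S := qp (-2) ^ n
  have hQS : Q * S = 1 := qp_two_mul_qp_neg_two n
  have hI := Ring.mul_inverse_cancel _ (isUnit_one_sub_qp_pow N n l.pos.ne' hn)
  change (1 - Q ^ N) * Ring.inverse (1 - Q ^ N) = 1 at hI
  set I := Ring.inverse (1 - Q ^ N)
  have hN : Q ^ N * S ^ N = 1 := by rw [← mul_pow, hQS, one_pow]
  -- The dilations are now by inverse powers, so `Q` and `S` change roles; since `Q S = 1`, the
  -- inverse of `1 - S^N` is `-Q^N / (1 - Q^N)`. The resulting sum is the negative of the one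
  -- needed.
  have h := geom_total S Q (-(Q ^ N * I)) (by rw [mul_comm, hQS]) N l
    (by linear_combination hI + I * hN) l.2
  rw [← neg_eq_zero, ← Finset.sum_neg_distrib]
  refine (Finset.sum_congr rfl fun j _ => ?_).trans h
  have h2 : (1 - S) * (1 - Q * S ^ N) * (-(Q ^ N * I)) = -((1 - Q) * (1 - S * Q ^ N) * I) := by
    linear_combination (I * Q ^ N - I) * hQS + I * (1 - S) * Q * hN
  rw [h2]
  split_ifs <;> ring

end KK
/-! ### Laurent series with operator coefficients -/

section Laurent

open HahnSeries

variable {R : Type*} [Ring R]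

/-- The Laurent series with the given coefficients, or `0` if the support is not bounded below. -/
def toLaurent (f : ℤ → R) : R⸨X⸩ :=
  open scoped Classical in
  if h : BddBelow (Function.support f) then ofSuppBddBelow f h else 0

theorem coeff_toLaurent {f : ℤ → R} (h : ∃ L, ∀ n < L, f n = 0) : (toLaurent f).coeff = f := by
  have h' : BddBelow (Function.support f) := by
    obtain ⟨L, hL⟩ := h
    exact ⟨L, fun n hn => not_lt.1 fun h => hn (hL n h)⟩
  rw [toLaurent, dif_pos h', coeff_ofSuppBddBelow]

/-- Any finite index set outside which the terms vanish may be used, so two products can be compared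
over one set. -/
theorem coeff_mul_eq_sum (x y : R⸨X⸩) (a : ℤ) (s : Finset ℤ)
    (hs : ∀ i ∉ s, x.coeff i * y.coeff (a - i) = 0) :
    (x * y).coeff a = ∑ i ∈ s, x.coeff i * y.coeff (a - i) := by
  rw [coeff_mul]
  classical
  have hinj : Set.InjOn (fun ij : ℤ × ℤ => ij.1)
      (Finset.antidiagonal x.isPWO_support y.isPWO_support a : Set (ℤ × ℤ)) := by
    rintro ⟨i, j⟩ hi ⟨i', j'⟩ hj h
    simp only [Finset.mem_coe, Finset.mem_antidiagonal] at hi hj h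
    ext <;> simp <;> omega
  have h1 : ∑ ij ∈ Finset.antidiagonal x.isPWO_support y.isPWO_support a,
      x.coeff ij.1 * y.coeff ij.2 =
      ∑ i ∈ (Finset.antidiagonal x.isPWO_support y.isPWO_support a).image (fun ij => ij.1),
        x.coeff i * y.coeff (a - i) := by
    rw [Finset.sum_image hinj]
    refine Finset.sum_congr rfl fun ij hij => ?_
    rw [Finset.mem_antidiagonal] at hij
    rw [← hij.2.2, add_sub_cancel_left]
  rw [h1]
  have h2 : ∀ i ∉ (Finset.antidiagonal x.isPWO_support y.isPWO_support a).image
      (fun ij => ij.1), x.coeff i * y.coeff (a - i) = 0 := by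
    intro i hi
    by_contra h
    refine hi (Finset.mem_image.2 ⟨(i, a - i), ?_, rfl⟩)
    rw [Finset.mem_antidiagonal]
    exact ⟨left_ne_zero_of_mul h, right_ne_zero_of_mul h, by simp⟩
  rw [← finsum_eq_sum_of_support_subset, ← finsum_eq_sum_of_support_subset]
  · intro i hi
    by_contra h
    exact hi (hs i h)
  · intro i hi
    by_contra h
    exact hi (h2 i h)

theorem exists_finset_coeff_mul (x y : R⸨X⸩) (a : ℤ) :
    ∃ s : Finset ℤ, ∀ i ∉ s, x.coeff i * y.coeff (a - i) = 0 := by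
  have hb : ∀ z : R⸨X⸩, ∃ L : ℤ, ∀ n < L, z.coeff n = 0 := by
    intro z
    refine ⟨z.order, fun n hn => coeff_eq_zero_of_lt_order hn⟩
  obtain ⟨L, hL⟩ := hb x
  obtain ⟨M, hM⟩ := hb y
  refine ⟨Finset.Icc L (a - M), fun i hi => ?_⟩
  rw [Finset.mem_Icc, not_and_or, not_le, not_le] at hi
  rcases hi with hi | hi
  · rw [hL i hi, zero_mul]
  · rw [hM (a - i) (by omega), mul_zero]

theorem commute_of_coeff {x y : R⸨X⸩} (h : ∀ i j, Commute (x.coeff i) (y.coeff j)) :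
    Commute x y := by
  ext a
  obtain ⟨s, hs⟩ := exists_finset_coeff_mul x y a
  rw [coeff_mul_eq_sum x y a s hs, coeff_mul_eq_sum y x a (s.image fun i => a - i)]
  · rw [Finset.sum_image (fun i _ j _ hij => by simpa using hij)]
    refine Finset.sum_congr rfl fun i _ => ?_
    rw [sub_sub_cancel]
    exact h _ _
  · intro i hi
    have : a - i ∉ s := fun h' => hi (Finset.mem_image.2 ⟨a - i, h', by simp⟩)
    have h2 := hs _ this
    rw [sub_sub_cancel] at h2
    rw [← h2]
    exact (h _ _).symm

/-- A product of two Laurent series that involve only the powers `(z^ε)^n`, `n ≥ 0`. -/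
theorem coeff_mul_of_oneSided (ε : ℤ) (hε : ε = 1 ∨ ε = -1) {x y : R⸨X⸩}
    (hx : ∀ n : ℤ, ε * n < 0 → x.coeff n = 0) (hy : ∀ n : ℤ, ε * n < 0 → y.coeff n = 0) :
    (∀ n : ℤ, ε * n < 0 → (x * y).coeff n = 0) ∧
    ∀ n : ℕ, (x * y).coeff (ε * n) =
      ∑ ij ∈ Finset.HasAntidiagonal.antidiagonal n, x.coeff (ε * ij.1) * y.coeff (ε * ij.2) := by
  have hεε : ε * ε = 1 := by rcases hε with rfl | rfl <;> rfl
  have hinj : Function.Injective fun i : ℕ => ε * (i : ℤ) := by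
    rcases hε with rfl | rfl <;> intro i j h <;> simp at h <;> exact h
  constructor
  · intro n hn
    rw [coeff_mul_eq_sum x y n ∅, Finset.sum_empty]
    intro i _
    by_cases hi : ε * i < 0
    · rw [hx i hi, zero_mul]
    · rw [hy (n - i) (by rw [mul_sub]; omega), mul_zero]
  · intro n
    rw [coeff_mul_eq_sum x y _ ((Finset.range (n + 1)).image fun i : ℕ => ε * (i : ℤ)),
      Finset.sum_image (fun i _ j _ h => hinj h), Finset.Nat.sum_antidiagonal_eq_sum_range_succ
        (fun i j => x.coeff (ε * i) * y.coeff (ε * j))]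
    · refine Finset.sum_congr rfl fun i hi => ?_
      rw [Finset.mem_range] at hi
      rw [Nat.cast_sub (by omega), mul_sub]
    · intro i hi
      by_cases h1 : ε * i < 0
      · rw [hx i h1, zero_mul]
      · by_cases h2 : ε * (ε * n - i) < 0
        · rw [hy _ h2, mul_zero]
        · refine absurd (Finset.mem_image.2 ⟨(ε * i).toNat, ?_, ?_⟩) hi
          · rw [mul_sub, ← mul_assoc, hεε, one_mul] at h2
            rw [Finset.mem_range]
            omega
          · rw [Int.toNat_of_nonneg (not_lt.1 h1), ← mul_assoc, hεε, one_mul]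

variable {V : Type*} [AddCommGroup V] [Module R V]

/-- The two series have the same values at the vector `e`. -/
def AgreeAt (e : V) (x y : R⸨X⸩) : Prop := ∀ n, x.coeff n • e = y.coeff n • e

theorem AgreeAt.mul_left {e : V} {x y : R⸨X⸩} (h : AgreeAt e x y) (z : R⸨X⸩) :
    AgreeAt e (z * x) (z * y) := by
  intro a
  obtain ⟨s, hs⟩ := exists_finset_coeff_mul z x a
  obtain ⟨t, ht⟩ := exists_finset_coeff_mul z y a
  classical
  rw [coeff_mul_eq_sum z x a (s ∪ t) fun i hi => hs i fun h => hi (Finset.mem_union_left _ h),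
    coeff_mul_eq_sum z y a (s ∪ t) fun i hi => ht i fun h => hi (Finset.mem_union_right _ h),
    Finset.sum_smul, Finset.sum_smul]
  refine Finset.sum_congr rfl fun i _ => ?_
  rw [mul_smul, mul_smul, h]

/-- The equalities hold only at the vector `e`, so an operator must stand next to `e` before it can
be replaced. The commutation hypotheses allow this, and the order of the `y i` is reversed in the
process. -/
theorem AgreeAt.list_prod {e : V} {ι : Type*} {c d x y : ι → R⸨X⸩}
    (h : ∀ i, AgreeAt e (c i * x i) (d i * y i))
    (hcx : ∀ i j, Commute (c i) (x j)) (hdx : ∀ i j, Commute (d i) (x j))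
    (hxy : ∀ i j, Commute (x i) (y j))
    (hcd : ∀ i j, Commute (c i) (d j)) (hcy : ∀ i j, Commute (c i) (y j))
    (hdy : ∀ i j, Commute (d i) (y j)) (hdd : ∀ i j, Commute (d i) (d j)) (L : List ι) :
    AgreeAt e ((L.map c).prod * (L.map x).prod)
      ((L.map d).prod * (L.map y).reverse.prod) := by
  induction L with
  | nil => intro n; simp
  | cons i L ih =>
    simp only [List.map_cons, List.prod_cons, List.reverse_cons, List.prod_append, List.prod_nil,
      mul_one]
    have com : ∀ {u : R⸨X⸩} {v : ι → R⸨X⸩}, (∀ j, Commute u (v j)) →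
        Commute u (L.map v).prod := fun {u v} huv => Commute.list_prod_right _ _ (by
      simpa using fun j _ => huv j)
    have com' : ∀ {u : R⸨X⸩} {v : ι → R⸨X⸩}, (∀ j, Commute u (v j)) →
        Commute u (L.map v).reverse.prod := fun {u v} huv => Commute.list_prod_right _ _ (by
      simpa using fun j _ => huv j)
    set C := (L.map c).prod
    set D := (L.map d).prod
    set P := (L.map x).prod
    set Q := (L.map y).reverse.prod
    have e1 : c i * C * (x i * P) = (c i * x i) * (C * P) := by
      have : Commute C (x i) := (com fun j => (hcx j i).symm).symm
      rw [mul_assoc, ← mul_assoc C, this.eq, mul_assoc, mul_assoc]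
    have e2 : (c i * x i) * (D * Q) = (D * Q) * (c i * x i) := by
      refine Commute.mul_left ?_ ?_
      · exact (com fun j => hcd i j).mul_right (com' fun j => hcy i j)
      · exact (com fun j => (hdx j i).symm).mul_right (com' fun j => hxy i j)
    have e3 : (D * Q) * (d i * y i) = d i * D * (Q * y i) := by
      have h1 : Commute (d i) Q := com' fun j => hdy i j
      have h2 : Commute (d i) D := com fun j => hdd i j
      rw [mul_assoc, ← mul_assoc Q, ← h1.eq, mul_assoc, ← mul_assoc D, ← h2.eq]
    intro n
    -- The tail is replaced first, under `c i * x i`. This head then moves past the new tail to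
    -- reach `e`, where it is replaced in turn.
    rw [e1, ih.mul_left (c i * x i) n, e2, (h i).mul_left (D * Q) n, e3]

end Laurent
-- Infinite sums become finite modulo a power of `p`
section Sums

open PowerSeries

variable {N : ℕ}

/-- Divisibility by `p^m` in the completed free algebra. -/
def PDvd (m : ℕ) (x : Free N) : Prop := ∀ k < m, coeff k x = 0

theorem PDvd.mul_left {m : ℕ} {x : Free N} (h : PDvd m x) (y : Free N) : PDvd m (y * x) := by
  intro k hk
  rw [coeff_mul]
  refine Finset.sum_eq_zero fun ij hij => ?_
  rw [Finset.HasAntidiagonal.mem_antidiagonal] at hij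
  rw [h _ (by omega), mul_zero]

theorem PDvd.mul_right {m : ℕ} {x : Free N} (h : PDvd m x) (y : Free N) : PDvd m (x * y) := by
  intro k hk
  rw [coeff_mul]
  refine Finset.sum_eq_zero fun ij hij => ?_
  rw [Finset.HasAntidiagonal.mem_antidiagonal] at hij
  rw [h _ (by omega), zero_mul]

theorem pDvd_psum {ι : Type} {m : ℕ} {x : ι → Free N} (h : ∀ i, PDvd m (x i)) :
    PDvd m (psum x) := by
  intro k hk
  rw [psum, coeff_mk]
  simp [fun i => h i k hk]

theorem pDvd_sc {m : ℕ} {a : A} (h : p ^ m ∣ a) : PDvd m (sc a : Free N) := by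
  intro k hk
  rw [sc, coeff_map, PowerSeries.X_pow_dvd_iff.1 h k hk, map_zero]

theorem sc_mul (a b : A) : (sc (a * b) : Free N) = sc a * sc b := map_mul _ _ _

theorem sc_one : (sc 1 : Free N) = 1 := map_one _

theorem sc_zero : (sc 0 : Free N) = 0 := map_zero _

theorem sc_comm (a : A) (x : Free N) : sc a * x = x * sc a := by
  ext1 n
  rw [coeff_mul, coeff_mul, ← Finset.Nat.sum_antidiagonal_swap]
  refine Finset.sum_congr rfl fun ij _ => ?_
  simp only [sc, coeff_map, Prod.fst_swap, Prod.snd_swap]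
  exact Algebra.commutes _ _

theorem sc_p_pow (m : ℕ) : (sc (p ^ m) : Free N) = PowerSeries.X ^ m := by
  rw [sc, p, map_pow, map_X]

theorem PDvd.exists_eq {m : ℕ} {x : Free N} (h : PDvd m x) : ∃ y, x = sc (p ^ m) * y := by
  refine ⟨PowerSeries.mk fun n => coeff (n + m) x, ?_⟩
  rw [sc_p_pow]
  ext1 n
  rw [coeff_X_pow_mul']
  split_ifs with hn
  · rw [coeff_mk, Nat.sub_add_cancel hn]
  · exact h n (not_le.1 hn)

/-- `a(z)` tends to zero `p`-adically in the direction of negative powers of `z`. -/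
def TendsBelow (a : Cur N) : Prop := ∀ m : ℕ, ∃ L : ℤ, ∀ n < L, PDvd m (a n)

theorem tendsBelow_of_dvd {a : Cur N} (h : ∀ n, PDvd (-n).toNat (a n)) : TendsBelow a :=
  fun m => ⟨-m, fun n hn k hk => h n k (by omega)⟩

theorem tendsBelow_kP (l : Fin N) : TendsBelow (kP l) :=
  tendsBelow_of_dvd fun _ => (pDvd_sc dvd_rfl).mul_right _

theorem tendsBelow_kPinv (l : Fin N) : TendsBelow (kPinv l) :=
  tendsBelow_of_dvd fun _ => (pDvd_sc dvd_rfl).mul_right _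

theorem tendsBelow_oneCur : TendsBelow (oneCur : Cur N) :=
  fun m => ⟨0, fun n hn k _ => by simp [oneCur, hn.ne]⟩

theorem TendsBelow.dil {a : Cur N} (h : TendsBelow a) (m : ℤ) : TendsBelow (dil m a) := fun M => by
  obtain ⟨L, hL⟩ := h M
  exact ⟨L, fun n hn => (hL n hn).mul_left _⟩

theorem TendsBelow.conv {a b : Cur N} (ha : TendsBelow a) (hb : TendsBelow b) :
    TendsBelow (conv a b) := fun m => by
  obtain ⟨L, hL⟩ := ha m
  obtain ⟨M, hM⟩ := hb m
  refine ⟨L + M, fun n hn => pDvd_psum fun i => ?_⟩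
  by_cases hi : i < L
  · exact (hL i hi).mul_right _
  · exact (hM (n - i) (by omega)).mul_left _

variable {U : Type*} [Ring U] {m : ℕ}

/-- A ring homomorphism that kills the multiples of `p^m`. -/
def KillsP (m : ℕ) (π : Free N →+* U) : Prop := ∀ x, PDvd m x → π x = 0

variable {π : Free N →+* U} (hπ : KillsP m π)

include hπ

/-- Only the coefficients of `p^k` with `k < m` matter under `π`, and to those the members outside
`s` contribute nothing. -/
theorem KillsP.map_psum {ι : Type} {x : ι → Free N} (s : Finset ι)
    (hs : ∀ i ∉ s, PDvd m (x i)) : π (psum x) = ∑ i ∈ s, π (x i) := by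
  rw [← map_sum, ← sub_eq_zero, ← map_sub]
  refine hπ _ fun k hk => ?_
  rw [map_sub, sub_eq_zero, psum, coeff_mk, map_sum, finsum_eq_sum_of_support_subset]
  intro i hi
  by_contra h
  exact hi (hs i h k hk)

theorem KillsP.map_conv {a b : Cur N} (ha : TendsBelow a) (hb : TendsBelow b) (n : ℤ) :
    ∃ s : Finset ℤ, (∀ i ∉ s, π (a i) = 0 ∨ π (b (n - i)) = 0) ∧
      π (conv a b n) = ∑ i ∈ s, π (a i) * π (b (n - i)) := by
  obtain ⟨L, hL⟩ := ha m
  obtain ⟨M, hM⟩ := hb m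
  have h : ∀ i ∉ Finset.Icc L (n - M), PDvd m (a i) ∨ PDvd m (b (n - i)) := by
    intro i hi
    rw [Finset.mem_Icc, not_and_or, not_le, not_le] at hi
    rcases hi with hi | hi
    · exact Or.inl (hL i hi)
    · exact Or.inr (hM (n - i) (by omega))
  refine ⟨Finset.Icc L (n - M), fun i hi => (h i hi).imp (hπ _) (hπ _), ?_⟩
  rw [conv, hπ.map_psum (Finset.Icc L (n - M)) fun i hi =>
    (h i hi).elim (fun h => h.mul_right _) fun h => h.mul_left _]
  simp only [map_mul]

end Sums
/-! ### Operators on series with coefficients in a quotient by a power of `p` -/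

section Operators

variable {U : Type*} [Ring U]

/-- Left multiplication of a series by an element. -/
def leftMul (u : U) : Module.End ℤ (ℤ → U) where
  toFun v s := u * v s
  map_add' v w := by ext s; simp [mul_add]
  map_smul' c v := funext fun s => mul_smul_comm c u (v s)

/-- Right multiplication of a series by an element. -/
def rightMul (u : U) : Module.End ℤ (ℤ → U) where
  toFun v s := v s * u
  map_add' v w := by ext s; simp [add_mul]
  map_smul' c v := funext fun s => smul_mul_assoc c (v s) u

/-- Translation of the exponents by `n`. -/
def shiftOp (U : Type*) [Ring U] (n : ℤ) : Module.End ℤ (ℤ → U) where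
  toFun v s := v (s + n)
  map_add' _ _ := rfl
  map_smul' _ _ := rfl

theorem leftMul_smul (u : U) (v : ℤ → U) (s : ℤ) : (leftMul u • v) s = u * v s := rfl

theorem rightMul_smul (u : U) (v : ℤ → U) (s : ℤ) : (rightMul u • v) s = v s * u := rfl

theorem shiftOp_smul (n : ℤ) (v : ℤ → U) (s : ℤ) : (shiftOp U n • v) s = v (s + n) := rfl

theorem leftMul_zero : leftMul (0 : U) = 0 := by
  refine LinearMap.ext fun v => funext fun s => zero_mul (v s)

theorem rightMul_zero : rightMul (0 : U) = 0 := by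
  refine LinearMap.ext fun v => funext fun s => mul_zero (v s)

theorem leftMul_one : leftMul (1 : U) = 1 := by
  refine LinearMap.ext fun v => funext fun s => one_mul (v s)

theorem rightMul_one : rightMul (1 : U) = 1 := by
  refine LinearMap.ext fun v => funext fun s => mul_one (v s)

theorem leftMul_mul (u w : U) : leftMul (u * w) = leftMul u * leftMul w := by
  refine LinearMap.ext fun v => funext fun s => mul_assoc u w (v s)

theorem rightMul_mul (u w : U) : rightMul (u * w) = rightMul w * rightMul u := by
  refine LinearMap.ext fun v => funext fun s => (mul_assoc (v s) u w).symm

theorem leftMul_sum {ι : Type*} (s : Finset ι) (u : ι → U) :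
    leftMul (∑ i ∈ s, u i) = ∑ i ∈ s, leftMul (u i) := by
  refine LinearMap.ext fun v => funext fun t => ?_
  rw [LinearMap.sum_apply, Finset.sum_apply]
  exact Finset.sum_mul _ _ _

theorem rightMul_sum {ι : Type*} (s : Finset ι) (u : ι → U) :
    rightMul (∑ i ∈ s, u i) = ∑ i ∈ s, rightMul (u i) := by
  refine LinearMap.ext fun v => funext fun t => ?_
  rw [LinearMap.sum_apply, Finset.sum_apply]
  exact Finset.mul_sum _ _ _

theorem commute_leftMul_rightMul (u w : U) : Commute (leftMul u) (rightMul w) :=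
  LinearMap.ext fun v => funext fun s => (mul_assoc u (v s) w).symm

theorem commute_leftMul_shiftOp (u : U) (n : ℤ) : Commute (leftMul u) (shiftOp U n) := rfl

theorem commute_rightMul_shiftOp (u : U) (n : ℤ) : Commute (rightMul u) (shiftOp U n) := rfl

theorem shiftOp_add (m n : ℤ) : shiftOp U (m + n) = shiftOp U m * shiftOp U n :=
  LinearMap.ext fun v => funext fun s => congrArg v (add_assoc s m n).symm

theorem shiftOp_zero : shiftOp U 0 = 1 :=
  LinearMap.ext fun v => funext fun s => congrArg v (add_zero s)

theorem commute_shiftOp (m n : ℤ) : Commute (shiftOp U m) (shiftOp U n) := by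
  rw [Commute, SemiconjBy, ← shiftOp_add, ← shiftOp_add, add_comm]

theorem commute_leftMul {u w : U} (h : Commute u w) : Commute (leftMul u) (leftMul w) := by
  rw [Commute, SemiconjBy, ← leftMul_mul, ← leftMul_mul, h.eq]

end Operators

/-! ### Currents and structure functions as Laurent series of operators -/

section Actions

open PowerSeries

variable {N : ℕ} {U : Type*} [Ring U] (π : Free N →+* U) {m : ℕ}

/-- Left multiplication by the series `a(z)`. -/
def leftSer (a : Cur N) : (Module.End ℤ (ℤ → U))⸨X⸩ := toLaurent fun n => leftMul (π (a n))

/-- Right multiplication by the series `a(z)`. -/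
def rightSer (a : Cur N) : (Module.End ℤ (ℤ → U))⸨X⸩ := toLaurent fun n => rightMul (π (a n))

/-- Multiplication by the scalar series `φ((z/w)^ε)`. -/
def scalSer (ε : ℤ) (φ : A⟦X⟧) : (Module.End ℤ (ℤ → U))⸨X⸩ := toLaurent fun n =>
  if 0 ≤ ε * n then leftMul (π (sc (coeff (ε * n).toNat φ))) * shiftOp U n else 0

/-- The series `φ((z/w)^ε)` acts on series in `z` that are bounded below. -/
def Expandable (ε : ℤ) (φ : A⟦X⟧) : Prop := ε = 1 ∨ ε = -1 ∧ IsSmall φ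

theorem IsSmall.mul {φ ψ : A⟦X⟧} (hφ : IsSmall φ) (hψ : IsSmall ψ) : IsSmall (φ * ψ) := fun n => by
  rw [coeff_mul]
  refine Finset.dvd_sum fun ij hij => ?_
  rw [Finset.HasAntidiagonal.mem_antidiagonal] at hij
  rw [← hij, pow_add]
  exact mul_dvd_mul (hφ _) (hψ _)

theorem Expandable.mul {ε : ℤ} {φ ψ : A⟦X⟧} (hφ : Expandable ε φ) (hψ : Expandable ε ψ) :
    Expandable ε (φ * ψ) := by
  rcases hφ with rfl | ⟨rfl, hφ⟩
  · exact Or.inl rfl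
  · rcases hψ with h | ⟨-, hψ⟩
    · omega
    · exact Or.inr ⟨rfl, hφ.mul hψ⟩

variable {π} (hπ : KillsP m π)

theorem commute_map_sc (a : A) (x : Free N) : Commute (π (sc a)) (π x) := by
  rw [Commute, SemiconjBy, ← map_mul, ← map_mul, sc_comm]

include hπ

theorem KillsP.map_sc_of_dvd {a : A} {n : ℕ} (h : p ^ n ∣ a) (hn : m ≤ n) : π (sc a) = 0 :=
  hπ _ (pDvd_sc ((pow_dvd_pow p hn).trans h))

theorem KillsP.coeff_leftSer {a : Cur N} (ha : TendsBelow a) (n : ℤ) :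
    (leftSer π a).coeff n = leftMul (π (a n)) := by
  rw [leftSer, coeff_toLaurent]
  obtain ⟨L, hL⟩ := ha m
  exact ⟨L, fun n hn => by rw [hπ _ (hL n hn), leftMul_zero]⟩

theorem KillsP.coeff_rightSer {a : Cur N} (ha : TendsBelow a) (n : ℤ) :
    (rightSer π a).coeff n = rightMul (π (a n)) := by
  rw [rightSer, coeff_toLaurent]
  obtain ⟨L, hL⟩ := ha m
  exact ⟨L, fun n hn => by rw [hπ _ (hL n hn), rightMul_zero]⟩

theorem KillsP.coeff_scalSer {ε : ℤ} {φ : A⟦X⟧} (hφ : Expandable ε φ) (n : ℤ) :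
    (scalSer π ε φ).coeff n =
      if 0 ≤ ε * n then leftMul (π (sc (coeff (ε * n).toNat φ))) * shiftOp U n else 0 := by
  rw [scalSer, coeff_toLaurent]
  rcases hφ with rfl | ⟨rfl, hφ⟩
  · exact ⟨0, fun n hn => if_neg (by omega)⟩
  -- Here the support would extend to `-∞`, but coefficients beyond the `m`-th are divisible by
  -- `p^m` and vanish under `π`.
  · refine ⟨-m, fun n hn => ?_⟩
    rw [hπ.map_sc_of_dvd (hφ _) (by omega), leftMul_zero, zero_mul, ite_self]

theorem KillsP.scalSer_mul {ε : ℤ} {φ ψ : A⟦X⟧} (hφ : Expandable ε φ) (hψ : Expandable ε ψ) :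
    scalSer π ε (φ * ψ) = scalSer π ε φ * scalSer π ε ψ := by
  have hε : ε = 1 ∨ ε = -1 := hφ.imp_right And.left
  have hεε : ε * ε = 1 := by rcases hε with rfl | rfl <;> rfl
  obtain ⟨h1, h2⟩ := coeff_mul_of_oneSided ε hε (x := scalSer π ε φ) (y := scalSer π ε ψ)
    (fun n hn => by rw [hπ.coeff_scalSer hφ, if_neg (not_le.2 hn)])
    (fun n hn => by rw [hπ.coeff_scalSer hψ, if_neg (not_le.2 hn)])
  ext1
  funext n
  rw [hπ.coeff_scalSer (hφ.mul hψ)]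
  split_ifs with hn
  · obtain ⟨k, hk⟩ := Int.eq_ofNat_of_zero_le hn
    have hn' : n = ε * k := by rw [← hk, ← mul_assoc, hεε, one_mul]
    have hz : ∀ i : ℕ, ε * (ε * (i : ℤ)) = i := fun i => by rw [← mul_assoc, hεε, one_mul]
    rw [hk, hn', h2, Int.toNat_natCast, coeff_mul]
    simp only [hπ.coeff_scalSer hφ, hπ.coeff_scalSer hψ, hz, Nat.cast_nonneg, if_true,
      Int.toNat_natCast]
    rw [sc, map_sum, map_sum, leftMul_sum, Finset.sum_mul]
    refine Finset.sum_congr rfl fun ij hij => ?_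
    rw [Finset.HasAntidiagonal.mem_antidiagonal] at hij
    rw [map_mul, map_mul, leftMul_mul, ← hij, Nat.cast_add, mul_add, shiftOp_add]
    change leftMul (π (sc _)) * leftMul (π (sc _)) * _ = _
    rw [mul_assoc, mul_assoc, ← mul_assoc (leftMul (π (sc (coeff ij.2 ψ)))),
      (commute_leftMul_shiftOp _ _).eq, mul_assoc]
  · exact (h1 n (not_le.1 hn)).symm

theorem KillsP.scalSer_one {ε : ℤ} (hε : ε = 1 ∨ ε = -1) :
    scalSer π ε 1 = 1 := by
  have h : Expandable ε 1 := hε.imp_right fun h => ⟨h, isSmall_one⟩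
  ext1
  funext n
  rw [hπ.coeff_scalSer h, HahnSeries.coeff_one]
  have hn : (ε * n).toNat = 0 ∧ 0 ≤ ε * n ↔ n = 0 := by
    rcases hε with rfl | rfl <;> omega
  by_cases h0 : n = 0
  · subst h0
    simp [sc_one, leftMul_one, shiftOp_zero]
  · rw [if_neg h0]
    split_ifs with h1
    · rw [coeff_one, if_neg (fun h2 => h0 (hn.1 ⟨h2, h1⟩)), sc_zero, map_zero, leftMul_zero,
        zero_mul]
    · rfl

theorem KillsP.list_prod_scalSer {ι : Type*} {ε : ℤ} (hε : ε = 1 ∨ ε = -1) {φ : ι → A⟦X⟧}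
    (hφ : ∀ i, Expandable ε (φ i)) (L : List ι) :
    Expandable ε (L.map φ).prod ∧
      (L.map fun i => scalSer π ε (φ i)).prod = scalSer π ε (L.map φ).prod := by
  induction L with
  | nil => exact ⟨hε.imp_right fun h => ⟨h, isSmall_one⟩, (hπ.scalSer_one hε).symm⟩
  | cons i L ih =>
    simp only [List.map_cons, List.prod_cons]
    exact ⟨(hφ i).mul ih.1, by rw [hπ.scalSer_mul (hφ i) ih.1, ih.2]⟩

theorem KillsP.leftSer_conv {a b : Cur N} (ha : TendsBelow a) (hb : TendsBelow b) :
    leftSer π (conv a b) = leftSer π a * leftSer π b := by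
  ext1
  funext n
  obtain ⟨s, hs, h⟩ := hπ.map_conv ha hb n
  rw [hπ.coeff_leftSer (ha.conv hb), h, coeff_mul_eq_sum _ _ n s, leftMul_sum]
  · refine Finset.sum_congr rfl fun i _ => ?_
    rw [hπ.coeff_leftSer ha, hπ.coeff_leftSer hb, leftMul_mul]
  · intro i hi
    rw [hπ.coeff_leftSer ha, hπ.coeff_leftSer hb]
    rcases hs i hi with h | h <;> rw [h, leftMul_zero]
    · rw [zero_mul]
    · rw [mul_zero]

/-- Right multiplications compose in the opposite order, hence the reflection `i ↦ n - i` of the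
summation index. -/
theorem KillsP.rightSer_conv {a b : Cur N} (ha : TendsBelow a) (hb : TendsBelow b) :
    rightSer π (conv a b) = rightSer π b * rightSer π a := by
  ext1
  funext n
  obtain ⟨s, hs, h⟩ := hπ.map_conv ha hb n
  rw [hπ.coeff_rightSer (ha.conv hb), h,
    coeff_mul_eq_sum _ _ n (s.image fun i => n - i), rightMul_sum,
    Finset.sum_image (fun i _ j _ hij => by simpa using hij)]
  · refine Finset.sum_congr rfl fun i _ => ?_
    rw [hπ.coeff_rightSer ha, hπ.coeff_rightSer hb, rightMul_mul, sub_sub_cancel]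
  · intro i hi
    rw [hπ.coeff_rightSer ha, hπ.coeff_rightSer hb]
    have hi' : n - i ∉ s := fun h' => hi (Finset.mem_image.2 ⟨n - i, h', by simp⟩)
    have := hs _ hi'
    rw [sub_sub_cancel] at this
    rcases this with h | h <;> rw [h, rightMul_zero]
    · rw [mul_zero]
    · rw [zero_mul]

theorem KillsP.ser_one : leftSer π oneCur = 1 ∧ rightSer π oneCur = 1 := by
  constructor <;> ext1 <;> funext n <;> rw [HahnSeries.coeff_one]
  · rw [hπ.coeff_leftSer tendsBelow_oneCur, oneCur]
    split_ifs
    · rw [map_one, leftMul_one]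
    · rw [map_zero, leftMul_zero]
  · rw [hπ.coeff_rightSer tendsBelow_oneCur, oneCur]
    split_ifs
    · rw [map_one, rightMul_one]
    · rw [map_zero, rightMul_zero]

omit hπ in
theorem tendsBelow_foldr {L : List (Cur N)} (h : ∀ a ∈ L, TendsBelow a) :
    TendsBelow (L.foldr conv oneCur) := by
  induction L with
  | nil => exact tendsBelow_oneCur
  | cons a L ih =>
    exact (h a List.mem_cons_self).conv (ih fun b hb => h b (List.mem_cons_of_mem _ hb))

theorem KillsP.ser_foldr {L : List (Cur N)} (h : ∀ a ∈ L, TendsBelow a) :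
    leftSer π (L.foldr conv oneCur) = (L.map (leftSer π)).prod ∧
      rightSer π (L.foldr conv oneCur) = (L.map (rightSer π)).reverse.prod := by
  induction L with
  | nil => simpa using hπ.ser_one
  | cons a L ih =>
    have ha := h a List.mem_cons_self
    have hL : ∀ b ∈ L, TendsBelow b := fun b hb => h b (List.mem_cons_of_mem _ hb)
    obtain ⟨h1, h2⟩ := ih hL
    simp only [List.foldr_cons, List.map_cons, List.prod_cons, List.reverse_cons, List.prod_append,
      List.prod_nil, mul_one]
    rw [hπ.leftSer_conv ha (tendsBelow_foldr hL), hπ.rightSer_conv ha (tendsBelow_foldr hL), h1, h2]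
    exact ⟨rfl, rfl⟩

theorem KillsP.map_two_of_isSmall {φ : A⟦X⟧} (hφ : IsSmall φ) (a b : Cur N) (r s : ℤ) :
    π (two φ a b r s) = ∑ n ∈ Finset.range m,
      π (sc (coeff n φ)) * (π (a (r + n)) * π (b (s - n))) := by
  rw [two, hπ.map_psum (Finset.range m)]
  · simp only [map_mul]
  · intro n hn
    rw [Finset.mem_range, not_lt] at hn
    exact (pDvd_sc ((pow_dvd_pow p hn).trans (hφ n))).mul_right _

/-- Here `ψ` need not have small coefficients: the sum is finite because `a` is lowered by `n` and
vanishes modulo `p^m` below `L`. -/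
theorem KillsP.map_two_of_below (ψ : A⟦X⟧) {a : Cur N} {L : ℤ} (hL : ∀ n < L, PDvd m (a n))
    (b : Cur N) (r s : ℤ) :
    π (two ψ b a s r) = ∑ n ∈ Finset.range (r - L + 1).toNat,
      π (sc (coeff n ψ)) * (π (b (s + n)) * π (a (r - n))) := by
  rw [two, hπ.map_psum (Finset.range (r - L + 1).toNat)]
  · simp only [map_mul]
  · intro n hn
    rw [Finset.mem_range, not_lt] at hn
    exact ((hL _ (by omega)).mul_left _).mul_left _

/-- Replacing `z₁` by `q^k z₁` requires `q^{-k}` in the argument `z₂/z₁`, and then the coefficient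
of `z₁^r` changes only by `q^{kr}`. -/
theorem KillsP.map_two_dil_left {φ : A⟦X⟧} (hφ : IsSmall φ) (k : ℤ) (a b : Cur N) (r s : ℤ) :
    π (two (rescale (qp (-k)) φ) (dil k a) b r s) = π (sc (qp (k * r))) * π (two φ a b r s) := by
  rw [hπ.map_two_of_isSmall (hφ.rescale _), hπ.map_two_of_isSmall hφ, Finset.mul_sum]
  refine Finset.sum_congr rfl fun n _ => ?_
  rw [coeff_rescale, dil, sc_mul, map_mul, map_mul, qp_pow, mul_add, qp_add, sc_mul, map_mul]
  have h : π (sc (qp (-k * n))) * π (sc (qp (k * n))) = 1 := by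
    rw [← map_mul, ← sc_mul, ← qp_add]
    simp [qp_zero, sc_one]
  have c1 := commute_map_sc (π := π) (qp (k * r)) (sc (coeff n φ))
  have c2 := commute_map_sc (π := π) (qp (k * n)) (sc (coeff n φ))
  have c3 := commute_map_sc (π := π) (qp (k * n)) (sc (qp (k * r)))
  calc _ = π (sc (qp (-k * n))) * (π (sc (coeff n φ)) * (π (sc (qp (k * r))) *
        π (sc (qp (k * n))))) * (π (a (r + n)) * π (b (s - n))) := by noncomm_ring
    _ = (π (sc (qp (-k * n))) * π (sc (qp (k * n)))) * (π (sc (qp (k * r))) *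
        π (sc (coeff n φ))) * (π (a (r + n)) * π (b (s - n))) := by
      rw [← c3.eq, ← mul_assoc (π (sc (coeff n φ))), ← c2.eq, c1.eq]
      noncomm_ring
    _ = _ := by rw [h, one_mul, mul_assoc]

theorem KillsP.map_two_dil_right (ψ : A⟦X⟧) (k : ℤ) {a : Cur N} (ha : TendsBelow a) (b : Cur N)
    (r s : ℤ) :
    π (two (rescale (qp k) ψ) b (dil k a) s r) = π (sc (qp (k * r))) * π (two ψ b a s r) := by
  obtain ⟨L, hL⟩ := ha m
  rw [hπ.map_two_of_below ψ hL, hπ.map_two_of_below (rescale (qp k) ψ) (a := dil k a) (L := L)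
    fun n hn => (hL n hn).mul_left _, Finset.mul_sum]
  refine Finset.sum_congr rfl fun n _ => ?_
  have h : qp (k * r) = qp k ^ n * qp (k * (r - n)) := by
    rw [qp_pow, ← qp_add]
    congr 1
    ring
  rw [coeff_rescale, dil, sc_mul, map_mul, map_mul, h, sc_mul, map_mul]
  have c1 := commute_map_sc (π := π) (qp (k * (r - n))) (b (s + n))
  have c2 := commute_map_sc (π := π) (qp (k * (r - n))) (sc (coeff n ψ))
  rw [← mul_assoc (π (b (s + n))), ← c1.eq]
  simp only [mul_assoc]
  congr 1
  simp only [← mul_assoc]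
  rw [c2.eq]

/-- The coefficient sequence of `b(z₂)` serves as the vector. Powers of `z₂` act on it by
translating exponents, while the Laurent variable records `z₁`. -/
theorem KillsP.agreeAt {φ ψ : A⟦X⟧} (hφ : IsSmall φ) {a b : Cur N} (ha : TendsBelow a)
    (h : ∀ r s, π (two φ a b r s) = π (two ψ b a s r)) :
    AgreeAt (fun s => π (b s)) (scalSer π (-1) φ * leftSer π a)
      (scalSer π 1 ψ * rightSer π a) := by
  intro r
  have hφ' : Expandable (-1) φ := Or.inr ⟨rfl, hφ⟩
  have hψ' : Expandable 1 ψ := Or.inl rfl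
  funext s
  have h1 : ((scalSer π (-1) φ * leftSer π a).coeff r • fun s => π (b s)) s =
      π (two φ a b r s) := by
    rw [hπ.map_two_of_isSmall hφ, coeff_mul_eq_sum _ _ r
      ((Finset.range m).image fun n : ℕ => -(n : ℤ)),
      Finset.sum_image (fun i _ j _ hij => by simpa using hij), Finset.sum_smul, Finset.sum_apply]
    · refine Finset.sum_congr rfl fun n _ => ?_
      rw [hπ.coeff_leftSer ha, hπ.coeff_scalSer hφ', if_pos (by omega), mul_smul, mul_smul,
        leftMul_smul, shiftOp_smul, leftMul_smul]
      simp [sub_eq_add_neg]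
    · intro i hi
      rw [hπ.coeff_scalSer hφ']
      split_ifs with h0
      · rw [hπ.map_sc_of_dvd (hφ _), leftMul_zero, zero_mul, zero_mul]
        by_contra hlt
        exact hi (Finset.mem_image.2 ⟨(-i).toNat, by rw [Finset.mem_range]; omega, by omega⟩)
      · rw [zero_mul]
  have h2 : ((scalSer π 1 ψ * rightSer π a).coeff r • fun s => π (b s)) s =
      π (two ψ b a s r) := by
    obtain ⟨L, hL⟩ := ha m
    rw [hπ.map_two_of_below ψ hL, coeff_mul_eq_sum _ _ r
      ((Finset.range (r - L + 1).toNat).image fun n : ℕ => (n : ℤ)),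
      Finset.sum_image (fun i _ j _ hij => by simpa using hij), Finset.sum_smul, Finset.sum_apply]
    · refine Finset.sum_congr rfl fun n _ => ?_
      rw [hπ.coeff_rightSer ha, hπ.coeff_scalSer hψ', if_pos (by omega), mul_smul, mul_smul,
        leftMul_smul, shiftOp_smul, rightMul_smul]
      simp
    · intro i hi
      rw [hπ.coeff_scalSer hψ', hπ.coeff_rightSer ha]
      split_ifs with h0
      · rw [hπ _ (hL _ _), rightMul_zero, mul_zero]
        by_contra hlt
        exact hi (Finset.mem_image.2 ⟨i.toNat, by rw [Finset.mem_range]; omega, by omega⟩)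
      · rw [zero_mul]
  rw [h1, h2, h]

/-- All operators involved commute except the `leftSer π (a i)` among themselves and the `rightSer π
(a i)` among themselves. Multiplying the relations and using that both scalar products are `1`
leaves left and right multiplication by the whole product, equal at `b`. -/
theorem KillsP.commute_foldr {ι : Type*} (L : List ι) {a : ι → Cur N}
    (ha : ∀ i, TendsBelow (a i)) (b : Cur N) {φ ψ : ι → A⟦X⟧} (hφ : ∀ i, IsSmall (φ i))
    (hφL : (L.map φ).prod = 1) (hψL : (L.map ψ).prod = 1)
    (h : ∀ i r s, π (two (φ i) (a i) b r s) = π (two (ψ i) b (a i) s r)) (n s : ℤ) :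
    Commute (π ((L.map a).foldr conv oneCur n)) (π (b s)) := by
  have hφ' : ∀ i, Expandable (-1) (φ i) := fun i => Or.inr ⟨rfl, hφ i⟩
  have hψ' : ∀ i, Expandable 1 (ψ i) := fun i => Or.inl rfl
  have hsl : ∀ {ε φ} (_ : Expandable ε φ) {c : Cur N} (_ : TendsBelow c),
      Commute (scalSer π ε φ) (leftSer π c) := fun {ε φ} h1 {c} h2 => commute_of_coeff fun i j => by
    rw [hπ.coeff_scalSer h1, hπ.coeff_leftSer h2]
    split_ifs
    · exact (commute_leftMul (commute_map_sc _ _)).mul_left (commute_leftMul_shiftOp _ _).symm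
    · exact Commute.zero_left _
  have hsr : ∀ {ε φ} (_ : Expandable ε φ) {c : Cur N} (_ : TendsBelow c),
      Commute (scalSer π ε φ) (rightSer π c) := fun {ε φ} h1 {c} h2 => commute_of_coeff fun i j => by
    rw [hπ.coeff_scalSer h1, hπ.coeff_rightSer h2]
    split_ifs
    · exact (commute_leftMul_rightMul _ _).mul_left (commute_rightMul_shiftOp _ _).symm
    · exact Commute.zero_left _
  have hss : ∀ {ε φ ε' φ'} (_ : Expandable ε φ) (_ : Expandable ε' φ'),
      Commute (scalSer π ε φ) (scalSer π ε' φ') := fun {ε φ ε' φ'} h1 h2 =>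
    commute_of_coeff fun i j => by
    rw [hπ.coeff_scalSer h1, hπ.coeff_scalSer h2]
    split_ifs
    · exact ((commute_leftMul (commute_map_sc _ _)).mul_right
        (commute_leftMul_shiftOp _ _)).mul_left
          ((commute_leftMul_shiftOp _ _).symm.mul_right (commute_shiftOp _ _))
    · exact Commute.zero_right _
    · exact Commute.zero_left _
    · exact Commute.zero_left _
  have key := AgreeAt.list_prod (e := fun s => π (b s)) (c := fun i => scalSer π (-1) (φ i))
    (d := fun i => scalSer π 1 (ψ i)) (x := fun i => leftSer π (a i))
    (y := fun i => rightSer π (a i)) (fun i => hπ.agreeAt (hφ i) (ha i) (h i))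
    (fun i j => hsl (hφ' i) (ha j)) (fun i j => hsl (hψ' i) (ha j))
    (fun i j => commute_of_coeff fun r s => by
      rw [hπ.coeff_leftSer (ha i), hπ.coeff_rightSer (ha j)]
      exact commute_leftMul_rightMul _ _)
    (fun i j => hss (hφ' i) (hψ' j)) (fun i j => hsr (hφ' i) (ha j))
    (fun i j => hsr (hψ' i) (ha j)) (fun i j => hss (hψ' i) (hψ' j)) L
  rw [(hπ.list_prod_scalSer (Or.inr rfl) hφ' L).2, (hπ.list_prod_scalSer (Or.inl rfl) hψ' L).2,
    hφL, hψL, hπ.scalSer_one (Or.inr rfl), hπ.scalSer_one (Or.inl rfl), one_mul, one_mul] at key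
  have haL : ∀ c ∈ L.map a, TendsBelow c := by simpa using fun i _ => ha i
  obtain ⟨h1, h2⟩ := hπ.ser_foldr haL
  rw [List.map_map] at h1 h2
  have h3 := congrFun (key n) s
  change ((L.map (leftSer π ∘ a)).prod.coeff n • fun s => π (b s)) s =
    ((L.map (rightSer π ∘ a)).reverse.prod.coeff n • fun s => π (b s)) s at h3
  rw [← h1, ← h2, hπ.coeff_leftSer (tendsBelow_foldr haL),
    hπ.coeff_rightSer (tendsBelow_foldr haL)] at h3
  exact h3

end Actions
-- Composition of dynamical shifts
section Shift

variable {N : ℕ}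

theorem shiftMero_algebraMap (a b : W N) (f : entire N) :
    shiftMero a b (algebraMap (entire N) (Mero N) f) =
      algebraMap (entire N) (Mero N) (shiftEntire a b f) :=
  IsFractionRing.ringEquivOfRingEquiv_algebraMap _ _

theorem shiftEntire_shiftEntire (a b a' b' : W N) (f : entire N) :
    shiftEntire a b (shiftEntire a' b' f) = shiftEntire (a + a') (b + b') f := by
  ext z
  change f.1 (z.1 + a + a', z.2 + b + b') = f.1 (z.1 + (a + a'), z.2 + (b + b'))
  rw [add_assoc, add_assoc]

theorem shiftEntire_zero (f : entire N) : shiftEntire 0 0 f = f := by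
  ext z
  change f.1 (z.1 + 0, z.2 + 0) = f.1 z
  rw [add_zero, add_zero]

theorem shiftMero_shiftMero (a b a' b' : W N) (f : Mero N) :
    shiftMero a b (shiftMero a' b' f) = shiftMero (a + a') (b + b') f := by
  obtain ⟨x, y, -, rfl⟩ := IsFractionRing.div_surjective (A := entire N) f
  simp only [map_div₀, shiftMero_algebraMap, shiftEntire_shiftEntire]

theorem shiftMero_zero (f : Mero N) : shiftMero 0 0 f = f := by
  obtain ⟨x, y, -, rfl⟩ := IsFractionRing.div_surjective (A := entire N) f
  simp only [map_div₀, shiftMero_algebraMap, shiftEntire_zero]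

theorem shift_shift (a b a' b' : W N) (f : FF N) :
    shift a b (shift a' b' f) = shift (a + a') (b + b') f := by
  ext1
  funext n
  exact shiftMero_shiftMero a b a' b' (f.coeff n)

theorem shift_zero (f : FF N) : shift 0 0 f = f := by
  ext1
  funext n
  exact shiftMero_zero (f.coeff n)

theorem sum_epsBar : ∑ l : Fin N, epsBar l = 0 := by
  ext i
  have hN : (N : ℂ) ≠ 0 := by exact_mod_cast i.pos.ne'
  rw [Submodule.coe_sum, Finset.sum_apply]
  simp [epsBar, Finset.sum_sub_distrib, hN]

end Shift

/-! ### Commutation of the product with each kind of generator modulo `p^m` -/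

section Commutation

open PowerSeries

variable {N : ℕ} {U : Type*} [Ring U] {π : Free N →+* U} {m : ℕ}

theorem kProd_eq : kProd N =
    ((List.finRange N).map fun l : Fin N => dil (-2 * (l.1 : ℤ)) (kP l)).foldr conv oneCur := by
  rw [kProd, List.ofFn_eq_map]

/-- With the trivial structure function, plain commutation becomes a relation of the general form.
-/
theorem two_one (a b : Cur N) (r s : ℤ) : two 1 a b r s = a r * b s := by
  ext1 k
  rw [two, psum, coeff_mk, finsum_eq_single _ 0]
  · simp [sc_one]
  · intro n hn
    rw [coeff_one, if_neg hn, sc_zero, zero_mul, map_zero]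

theorem rescale_scalar (c a : A) : rescale c (PowerSeries.C a) = PowerSeries.C a := by
  ext1 n
  rw [coeff_rescale, coeff_C]
  split_ifs with h
  · rw [h, pow_zero, one_mul]
  · rw [mul_zero]

section KillsP

variable (hπ : KillsP m π)

include hπ

theorem KillsP.map_two_C_mul (c : A) (ψ : A⟦X⟧) {a : Cur N} (ha : TendsBelow a) (b : Cur N)
    (r s : ℤ) :
    π (two (PowerSeries.C c * ψ) b a s r) = π (sc c * two ψ b a s r) := by
  obtain ⟨L, hL⟩ := ha m
  rw [map_mul, hπ.map_two_of_below _ hL, hπ.map_two_of_below _ hL, Finset.mul_sum]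
  refine Finset.sum_congr rfl fun n _ => ?_
  rw [coeff_C_mul, sc_mul, map_mul, mul_assoc]

theorem KillsP.commute_kProd (b : Cur N) {φ ψ : Fin N → A⟦X⟧} (hφ : ∀ l, IsSmall (φ l))
    (hφ1 : ((List.finRange N).map fun l : Fin N => rescale (qp (2 * (l.1 : ℤ))) (φ l)).prod = 1)
    (hψ1 : ((List.finRange N).map fun l : Fin N => rescale (qp (-2 * (l.1 : ℤ))) (ψ l)).prod = 1)
    (h : ∀ l r s, π (two (φ l) (kP l) b r s) = π (two (ψ l) b (kP l) s r)) (n s : ℤ) :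
    Commute (π (kProd N n)) (π (b s)) := by
  rw [kProd_eq]
  refine hπ.commute_foldr (List.finRange N) (fun l => (tendsBelow_kP l).dil _) b
    (fun l => (hφ l).rescale _) hφ1 hψ1 (fun l r s => ?_) n s
  have h1 := hπ.map_two_dil_left (hφ l) (-2 * (l.1 : ℤ)) (kP l) b r s
  rw [neg_mul, neg_neg] at h1
  rw [neg_mul, h1, h, ← hπ.map_two_dil_right _ _ (tendsBelow_kP l)]

variable (hrel : ∀ x y, Rel x y → π x = π y)

include hrel

theorem KillsP.commute_kProd_kP (l : Fin N) (n s : ℤ) :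
    Commute (π (kProd N n)) (π (kP l s)) := by
  refine hπ.commute_kProd (kP l) (φ := fun j => kkLeft N j l) (ψ := fun j => kkRight N j l)
    (fun j => isSmall_nomeExp _) (prod_kkLeft N l) (prod_kkRight N l) (fun j r s => ?_) n s
  rcases lt_trichotomy j l with h | rfl | h
  · have := hrel _ _ (.k_k' j l h r s)
    rw [nomeExp_eq_left, nomeExp_eq_right, rhoPP_eq, ← nomeExp_add, ← nomeExp_add] at this
    simp only [kkLeft, kkRight, Fin.lt_def.1 h, if_true]
    exact this
  · have := hrel _ _ (.k_k j r s)
    simp only [kkLeft, kkRight, lt_irrefl, if_true, if_false, add_zero]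
    rw [rhoPP_eq] at this
    exact this
  -- For `j > l` the relation is read from right to left, so its two structure functions exchange
  -- roles.
  · have := hrel _ _ (.k_k' l j h s r)
    rw [nomeExp_eq_left, nomeExp_eq_right, rhoPP_eq, ← nomeExp_add, ← nomeExp_add] at this
    have h1 : ¬ j.1 < l.1 := not_lt.2 (Fin.lt_def.1 h).le
    have h2 : ¬ j.1 = l.1 := (Fin.lt_def.1 h).ne'
    simp only [kkLeft, kkRight, h1, h2, if_false]
    exact this.symm

omit hrel hπ in
theorem prod_finRange_eq_one {j : Fin (N - 1)} {φ : Fin N → A⟦X⟧}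
    (h : φ (lo j) * φ (hi j) = 1) (h' : ∀ l, l ≠ lo j → l ≠ hi j → φ l = 1) :
    ((List.finRange N).map φ).prod = 1 := by
  have hne : lo j ≠ hi j := by simp [lo, hi]
  rw [← List.ofFn_eq_map, List.prod_ofFn, Fintype.prod_eq_mul (lo j) (hi j) hne, h]
  exact fun l hl => h' l hl.1 hl.2

omit hrel in
/-- The product of `k_1, …, k_N` commutes with a current that commutes with all but two adjacent
factors, if the structure functions of these two factors are inverse to each other. -/
theorem KillsP.commute_kProd_of_adjacent (j : Fin (N - 1)) (b : Cur N) (t : List A)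
    (a₁ a₂ b₁ b₂ c₁ c₂ : A) (hc : c₁ * c₂ = 1)
    (hl : qp 2 * (p * a₂) = p * b₁)
    (hl' : qp 2 * (p * b₂) = p * a₁)
    (x₁ x₂ y₁ y₂ : A) (hr : qp (-2) * x₂ = y₁) (hr' : qp (-2) * y₂ = x₁)
    (h₁ : ∀ r s, π (two (quo (poch (p * a₁) t) (poch (p * b₁) t)) (kP (lo j)) b r s) =
      π (sc c₁ * two (quo (poch x₁ t) (poch y₁ t)) b (kP (lo j)) s r))
    (h₂ : ∀ r s, π (two (quo (poch (p * a₂) t) (poch (p * b₂) t)) (kP (hi j)) b r s) =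
      π (sc c₂ * two (quo (poch x₂ t) (poch y₂ t)) b (kP (hi j)) s r))
    (h₃ : ∀ l, l ≠ lo j → l ≠ hi j → ∀ r s, π (kP l r * b s) = π (b s * kP l r)) (n s : ℤ) :
    Commute (π (kProd N n)) (π (b s)) := by
  have hne : hi j ≠ lo j := by simp [lo, hi]
  have hcast : ((hi j).1 : ℤ) = (lo j).1 + 1 := by simp [lo, hi]
  refine hπ.commute_kProd b
    (φ := fun l => if l = lo j then quo (poch (p * a₁) t) (poch (p * b₁) t) else
      if l = hi j then quo (poch (p * a₂) t) (poch (p * b₂) t) else 1)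
    (ψ := fun l => if l = lo j then PowerSeries.C c₁ * quo (poch x₁ t) (poch y₁ t) else
      if l = hi j then PowerSeries.C c₂ * quo (poch x₂ t) (poch y₂ t) else 1)
    (fun l => ?_) ?_ ?_ (fun l r s => ?_) n s
  · split_ifs
    · exact isSmall_quo_poch _ _ _
    · exact isSmall_quo_poch _ _ _
    · exact isSmall_one
  -- The additional `q²` at the upper index turns its numerator into the denominator of the lower
  -- factor, and conversely.
  · refine prod_finRange_eq_one (j := j) ?_ fun l h1 h2 => by simp [h1, h2]
    rw [if_pos rfl, if_neg hne, if_pos rfl, rescale_quo_poch, rescale_quo_poch, hcast, mul_add,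
      mul_one, qp_add, mul_assoc _ (qp 2), mul_assoc _ (qp 2), hl, hl', quo_poch_mul_quo_poch]
  · refine prod_finRange_eq_one (j := j) ?_ fun l h1 h2 => by simp [h1, h2]
    rw [if_pos rfl, if_neg hne, if_pos rfl, map_mul, map_mul, rescale_quo_poch, rescale_quo_poch,
      hcast, mul_add, mul_one, qp_add, mul_assoc _ (qp (-2)), mul_assoc _ (qp (-2)), hr, hr',
      mul_mul_mul_comm, quo_poch_mul_quo_poch, rescale_scalar, rescale_scalar, ← map_mul, hc, map_one,
      mul_one]
  · by_cases hl1 : l = lo j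
    · subst hl1
      simp only [if_true]
      rw [h₁, hπ.map_two_C_mul _ _ (tendsBelow_kP _)]
    · by_cases hl2 : l = hi j
      · subst hl2
        simp only [hne, if_true, if_false]
        rw [h₂, hπ.map_two_C_mul _ _ (tendsBelow_kP _)]
      · simp only [hl1, hl2, if_false]
        rw [two_one, two_one]
        exact h₃ l hl1 hl2 r s

theorem KillsP.commute_kProd_eC (j : Fin (N - 1)) (n s : ℤ) :
    Commute (π (kProd N n)) (π (eC j s)) := by
  have hp : ∀ k, pStar * gam 2 * qp k = p * (gam (-4) * gam 2 * qp k) := fun k => by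
    rw [pStar]; ring
  have hq : ∀ (g : A) (i k : ℤ), qp i * (g * qp k) = g * qp (i + k) := fun g i k => by
    rw [qp_add]; ring
  refine hπ.commute_kProd_of_adjacent j (eC j) [pStar]
    (gam (-4) * gam 2 * qp (2 - lab j)) (gam (-4) * gam 2 * qp (-2 - lab j))
    (gam (-4) * gam 2 * qp (-lab j)) (gam (-4) * gam 2 * qp (-lab j))
    (qp (-1)) (qp 1) (by rw [← qp_add]; simp [qp_zero]) ?_ ?_
    (gam (-2) * qp (lab j)) (gam (-2) * qp (lab j))
    (gam (-2) * qp (-2 + lab j)) (gam (-2) * qp (2 + lab j)) (hq _ _ _) ?_ ?_ ?_ ?_ n s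
  · rw [← hp, ← hp, hq]
    congr 2
    ring
  · rw [← hp, ← hp, hq]
    congr 2
  · rw [hq]
    congr 2
    ring
  · intro r s
    rw [← hp, ← hp]
    exact hrel _ _ (.k_e j r s)
  · intro r s
    rw [← hp, ← hp]
    exact hrel _ _ (.k_e' j r s)
  · exact fun l h1 h2 r s => hrel _ _ (.k_e'' l j h1 h2 r s)

theorem KillsP.commute_kProd_fC (j : Fin (N - 1)) (n s : ℤ) :
    Commute (π (kProd N n)) (π (fC j s)) := by
  have hq : ∀ (g : A) (i k : ℤ), qp i * (g * qp k) = g * qp (i + k) := fun g i k => by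
    rw [qp_add]; ring
  refine hπ.commute_kProd_of_adjacent j (fC j) [p]
    (qp (-lab j)) (qp (-lab j)) (qp (2 - lab j)) (qp (-2 - lab j))
    (qp 1) (qp (-1)) (by rw [← qp_add]; simp [qp_zero]) (hq _ _ _) ?_
    (qp (-2 + lab j)) (qp (2 + lab j)) (qp (lab j)) (qp (lab j)) ?_ (qp_add _ _).symm
    (fun r s => hrel _ _ (.k_f j r s)) (fun r s => hrel _ _ (.k_f' j r s))
    (fun l h1 h2 r s => hrel _ _ (.k_f'' l j h1 h2 r s)) n s
  · rw [hq]
    congr 2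
    ring
  · rw [← qp_add]
    congr 1
    ring

theorem KillsP.fn_mul_foldr (L : List (Fin N)) (k : Fin N → ℤ) (φ : FF N) (n : ℤ) :
    π (sym (.fn φ)) * π ((L.map fun l => dil (k l) (kP l)).foldr conv oneCur n) =
      π ((L.map fun l => dil (k l) (kP l)).foldr conv oneCur n) *
        π (sym (.fn (shift (-(L.map epsBar).sum) (-(L.map epsBar).sum) φ))) := by
  induction L generalizing φ n with
  | nil =>
    simp only [List.map_nil, List.foldr_nil, List.sum_nil, neg_zero, shift_zero, oneCur]
    split_ifs <;> simp
  | cons l L ih =>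
    have hL : TendsBelow ((L.map fun l => dil (k l) (kP l)).foldr conv oneCur) :=
      tendsBelow_foldr (by simpa using fun l _ => (tendsBelow_kP l).dil (k l))
    obtain ⟨s, -, hs⟩ := hπ.map_conv ((tendsBelow_kP l).dil (k l)) hL n
    simp only [List.map_cons, List.foldr_cons, List.sum_cons]
    rw [hs, Finset.mul_sum, Finset.sum_mul]
    refine Finset.sum_congr rfl fun i _ => ?_
    have h1 : π (sym (.fn φ)) * π (dil (k l) (kP l) i) =
        π (dil (k l) (kP l) i) * π (sym (.fn (shift (-epsBar l) (-epsBar l) φ))) := by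
      have := hrel _ _ (.fn_k φ l i)
      rw [dil, map_mul, ← mul_assoc, ← (commute_map_sc _ _).eq, mul_assoc, ← map_mul, this,
        map_mul, mul_assoc]
    rw [← mul_assoc, h1, mul_assoc, ih, shift_shift, mul_assoc, ← neg_add_rev]

theorem KillsP.commute_kProd_fn (φ : FF N) (n : ℤ) :
    Commute (π (kProd N n)) (π (sym (.fn φ))) := by
  have h := hπ.fn_mul_foldr hrel (List.finRange N) (fun l => -2 * (l.1 : ℤ)) φ n
  rw [← kProd_eq, ← List.ofFn_eq_map (f := epsBar), List.sum_ofFn, sum_epsBar, neg_zero,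
    shift_zero] at h
  exact h.symm

theorem KillsP.commute_kPinv (l : Fin N) (u : U) (h : ∀ n, Commute u (π (kP l n))) (n : ℤ) :
    Commute u (π (kPinv l n)) := by
  have hx := tendsBelow_kP l
  have hy := tendsBelow_kPinv l
  have h1 : leftSer π (kP l) * leftSer π (kPinv l) = 1 := by
    rw [← hπ.leftSer_conv hx hy, ← hπ.ser_one.1, leftSer, leftSer]
    congr 1
    exact funext fun n => congrArg leftMul (hrel _ _ (.k_kinv l n))
  have h2 : leftSer π (kPinv l) * leftSer π (kP l) = 1 := by
    rw [← hπ.leftSer_conv hy hx, ← hπ.ser_one.1, leftSer, leftSer]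
    congr 1
    exact funext fun n => congrArg leftMul (hrel _ _ (.kinv_k l n))
  set c : (Module.End ℤ (ℤ → U))⸨X⸩ := HahnSeries.single 0 (leftMul u)
  have h3 : Commute c (leftSer π (kP l)) := commute_of_coeff fun i j => by
    rw [hπ.coeff_leftSer hx, HahnSeries.coeff_single]
    split_ifs
    · exact commute_leftMul (h j)
    · exact Commute.zero_left _
  have h4 : c * leftSer π (kPinv l) = leftSer π (kPinv l) * c := by
    calc c * leftSer π (kPinv l)
        = (leftSer π (kPinv l) * leftSer π (kP l)) * (c * leftSer π (kPinv l)) := by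
          rw [h2, one_mul]
      _ = leftSer π (kPinv l) * (leftSer π (kP l) * c) * leftSer π (kPinv l) := by noncomm_ring
      _ = leftSer π (kPinv l) * c * (leftSer π (kP l) * leftSer π (kPinv l)) := by
          rw [← h3.eq]; noncomm_ring
      _ = _ := by rw [h1, mul_one]
  -- An element of `U` is recovered from its left multiplication operator by applying the operator
  -- to the constant sequence `1`.
  have h5 := congrArg (fun x => (x.coeff n • (fun _ => 1 : ℤ → U)) 0) h4
  simp only [c, HahnSeries.coeff_single_zero_mul, HahnSeries.coeff_mul_single_zero,
    hπ.coeff_leftSer hy, mul_smul, leftMul_smul, mul_one] at h5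
  exact h5

end KillsP

end Commutation

/-! ### The quotient by the ideal of relations -/

section Quotient

variable {N : ℕ}

/-- The ideal generated by `J` and `p^m`. -/
def addPPow (J : TwoSidedIdeal (Free N)) (m : ℕ) : TwoSidedIdeal (Free N) :=
  TwoSidedIdeal.mk' {x | ∃ y, x - sc (p ^ m) * y ∈ J}
    ⟨0, by simp⟩
    (fun {x x'} ⟨y, hy⟩ ⟨y', hy'⟩ => ⟨y + y', by
      have := J.add_mem hy hy'
      rwa [sub_add_sub_comm, ← mul_add] at this⟩)
    (fun {x} ⟨y, hy⟩ => ⟨-y, by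
      have := J.neg_mem hy
      rwa [neg_sub', ← mul_neg] at this⟩)
    (fun {z x} ⟨y, hy⟩ => ⟨z * y, by
      have := J.mul_mem_left z _ hy
      rwa [mul_sub, ← mul_assoc, ← sc_comm, mul_assoc] at this⟩)
    (fun {x z} ⟨y, hy⟩ => ⟨y * z, by
      have := J.mul_mem_right _ z hy
      rwa [sub_mul, mul_assoc] at this⟩)

theorem mem_addPPow {J : TwoSidedIdeal (Free N)} {m : ℕ} {x : Free N} :
    x ∈ addPPow J m ↔ ∃ y, x - sc (p ^ m) * y ∈ J := TwoSidedIdeal.mem_mk' _ _ _ _ _ _ _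

theorem mk'_eq_iff (J : TwoSidedIdeal (Free N)) (x y : Free N) :
    J.ringCon.mk' x = J.ringCon.mk' y ↔ x - y ∈ J := by
  rw [← TwoSidedIdeal.rel_iff]
  exact RingCon.eq J.ringCon

theorem killsP_mk' (J : TwoSidedIdeal (Free N)) (m : ℕ) :
    KillsP m (addPPow J m).ringCon.mk' := fun x hx => by
  obtain ⟨y, rfl⟩ := hx.exists_eq
  rw [← map_zero (addPPow J m).ringCon.mk', mk'_eq_iff, mem_addPPow]
  exact ⟨y, by simp⟩

theorem le_addPPow {J : TwoSidedIdeal (Free N)} {x : Free N} (h : x ∈ J) (m : ℕ) :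
    x ∈ addPPow J m := mem_addPPow.2 ⟨0, by simpa using h⟩

theorem rel_mem_relIdeal {x y : Free N} (h : Rel x y) : x - y ∈ relIdeal N := by
  rw [relIdeal, TwoSidedIdeal.mem_sInf]
  exact fun J hJ => hJ.1 x y h

theorem isPClosed_relIdeal : IsPClosed (relIdeal N) := by
  intro x hx
  rw [relIdeal, TwoSidedIdeal.mem_sInf]
  intro J hJ
  refine hJ.2.1 x fun n => ?_
  obtain ⟨y, hy⟩ := hx n
  rw [relIdeal, TwoSidedIdeal.mem_sInf] at hy
  exact ⟨y, hy J hJ⟩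

theorem isPSaturated_relIdeal : IsPSaturated (relIdeal N) := by
  intro x hx
  rw [relIdeal, TwoSidedIdeal.mem_sInf] at hx ⊢
  exact fun J hJ => hJ.2.2 x (hx J hJ)

theorem mem_relIdeal_of_p_pow {m : ℕ} {x : Free N} (h : sc (p ^ m) * x ∈ relIdeal N) :
    x ∈ relIdeal N := by
  induction m with
  | zero => simpa [sc_one] using h
  | succ m ih =>
    rw [pow_succ', sc_mul, mul_assoc] at h
    exact ih (isPSaturated_relIdeal _ h)

/-- It suffices to check a relation modulo all powers of `p`. -/
theorem toU_eq_iff {x y : Free N} :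
    toU x = toU y ↔ ∀ m, (addPPow (relIdeal N) m).ringCon.mk' x =
      (addPPow (relIdeal N) m).ringCon.mk' y := by
  simp only [mk'_eq_iff, toU]
  exact ⟨fun h m => le_addPPow h m, fun h => isPClosed_relIdeal _ fun m => mem_addPPow.1 (h m)⟩

theorem toU_commute_iff {x y : Free N} :
    Commute (toU x) (toU y) ↔ ∀ m, Commute ((addPPow (relIdeal N) m).ringCon.mk' x)
      ((addPPow (relIdeal N) m).ringCon.mk' y) := by
  simp only [Commute, SemiconjBy, ← map_mul]
  exact toU_eq_iff

theorem mk'_eq_of_rel (m : ℕ) (x y : Free N) (h : Rel x y) :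
    (addPPow (relIdeal N) m).ringCon.mk' x = (addPPow (relIdeal N) m).ringCon.mk' y :=
  (mk'_eq_iff _ _ _).2 (le_addPPow (rel_mem_relIdeal h) m)

/-- The relations involve the positive modes of `k_l⁺` only as `p^m k_{l,m}`; the factor `p^m` is
cancelled by the absence of torsion. -/
theorem commute_toU_of_p_pow {m : ℕ} {x y : Free N}
    (h : Commute (toU x) (toU (sc (p ^ m) * y))) : Commute (toU x) (toU y) := by
  rw [Commute, SemiconjBy, ← map_mul, ← map_mul] at h ⊢
  rw [toU, mk'_eq_iff] at h ⊢
  refine mem_relIdeal_of_p_pow (m := m) ?_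
  rwa [← mul_assoc, ← sc_comm, mul_assoc, mul_assoc, ← mul_sub] at h

theorem commute_toU_kProd_sym (n : ℤ) (g : Gen N) : Commute (toU (kProd N n)) (toU (sym g)) := by
  have hk : ∀ l s, Commute (toU (kProd N n)) (toU (kP l s)) := fun l s =>
    -- Commutation is checked in the quotient by the ideal and `p^m`, for every `m`.
    toU_commute_iff.2 fun m => (killsP_mk' _ m).commute_kProd_kP (mk'_eq_of_rel m) l n s
  cases g with
  | fn φ =>
    exact toU_commute_iff.2 fun m => (killsP_mk' _ m).commute_kProd_fn (mk'_eq_of_rel m) φ n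
  | e j i =>
    have : Commute (toU (kProd N n)) (toU (eC j (-i))) := toU_commute_iff.2 fun m =>
      (killsP_mk' _ m).commute_kProd_eC (mk'_eq_of_rel m) j n (-i)
    rwa [eC, neg_neg] at this
  | f j i =>
    have : Commute (toU (kProd N n)) (toU (fC j (-i))) := toU_commute_iff.2 fun m =>
      (killsP_mk' _ m).commute_kProd_fC (mk'_eq_of_rel m) j n (-i)
    rwa [fC, neg_neg] at this
  | k l i =>
    have := hk l (-i)
    rw [kP, neg_neg] at this
    exact commute_toU_of_p_pow this
  | kinv l i =>
    have : Commute (toU (kProd N n)) (toU (kPinv l (-i))) := toU_commute_iff.2 fun m =>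
      (killsP_mk' _ m).commute_kPinv (mk'_eq_of_rel m) l _
        (fun s => toU_commute_iff.1 (hk l s) m) (-i)
    rw [kPinv, neg_neg] at this
    exact commute_toU_of_p_pow this

theorem commute_toU_sc (x : Free N) (a : A) : Commute (toU x) (toU (sc a)) := by
  rw [Commute, SemiconjBy, ← map_mul, ← map_mul, sc_comm]

/-- An element that commutes with the symbols is central. -/
theorem toU_mem_center {x : Free N} (h : ∀ g, Commute (toU x) (toU (sym g))) :
    toU x ∈ Subring.center (UPrime N) := by
  rw [Subring.mem_center_iff]
  have hC : ∀ y : FreeAlgebra B (Gen N), Commute (toU x) (toU (PowerSeries.C y)) := by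
    intro y
    induction y using FreeAlgebra.induction with
    | grade0 b =>
      have := commute_toU_sc x (PowerSeries.C b)
      rwa [sc, PowerSeries.map_C] at this
    | grade1 g => exact h g
    | mul a b ha hb =>
      rw [map_mul, map_mul]
      exact ha.mul_right hb
    | add a b ha hb =>
      rw [map_add, map_add]
      exact ha.add_right hb
  intro u
  obtain ⟨y, rfl⟩ : ∃ y, toU y = u := RingCon.mk'_surjective _ u
  refine Commute.symm (toU_commute_iff.2 fun m => ?_)
  -- The truncation of `y` below `p^m`: a finite sum of elements with which `toU x` commutes, and
  -- equal to `y` modulo `p^m`.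
  set t : Free N := ∑ k ∈ Finset.range m, PowerSeries.C (PowerSeries.coeff k y) * sc (p ^ k)
  have ht : Commute (toU x) (toU t) := by
    rw [map_sum]
    refine Commute.sum_right _ _ _ fun k _ => ?_
    rw [map_mul]
    exact (hC _).mul_right (commute_toU_sc _ _)
  have hy : (addPPow (relIdeal N) m).ringCon.mk' y = (addPPow (relIdeal N) m).ringCon.mk' t := by
    rw [← sub_eq_zero, ← map_sub]
    refine killsP_mk' _ m _ fun k hk => ?_
    simp only [t, map_sub, map_sum, sc_p_pow, PowerSeries.coeff_C_mul, PowerSeries.coeff_X_pow]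
    simp [hk]
  rw [hy]
  exact toU_commute_iff.1 ht m

end Quotient

end EllipticGL

end

theorem mainTheorem7 (N : ℕ) (hN : 2 ≤ N) (n : ℤ) :
    EllipticGL.KCoeff N n ∈ Subring.center (EllipticGL.UPrime N) :=
  EllipticGL.toU_mem_center (EllipticGL.commute_toU_kProd_sym n)
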